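/- Let $a<b$, $c<d$ and $Q=[a,b]\times[c,d]$. Let $B_{x,1},\dots,B_{x,R}$ and $B_{y,1},\dots,B_{y,L}$ be B-spline bases of degrees $p\ge 1$ and $q\ge 1$ for fixed knot sequences that are nondecreasing, whose basic intervals contain $[a,b]$ and $[c,d]$ respectively, and whose knots in the basic intervals are simple (so the splines have $p-1$, respectively $q-1$, continuous derivatives). For $\Theta\in\mathbb R^{R\times L}$ put $s(x,y,\Theta)=\sum_{r=1}^R\sum_{l=1}^L B_{x,r}(x)B_{y,l}(y)\theta_{rl}$. Let $h$ and $g$ be probability distributions on $[a,b]$ and $[c,d]$, and let the random variables $x_1,x_2,\dots\sim h$, $y_1,y_2,\dots\sim g$ and $\epsilon_1,\epsilon_2,\dots$ (identically distributed, with mean $0$ and finite variance) be mutually independent. For a surface $\mathcal S$ one observes $z_j=\mathcal S(x_j,y_j)+\epsilon_j$, $1\le j\le m$. Let $\widehat\Theta=\widehat\Theta_m(\mathcal S)=\mathrm{devec}\{(M^TM)^{-1}M^T\mathbf z\}$ be the least-squares coefficient matrix, where $\mathbf z=(z_1,\dots,z_m)^T$ and $M$ is the $m\times RL$ matrix whose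 $j$th row is $(B_y(y_j)\otimes B_x(x_j))^T$, with $B_x=(B_{x,1},\dots,B_{x,R})^T$ and $B_y=(B_{y,1},\dots,B_{y,L})^T$. Let $\mathbf S$ be the space of surfaces $\mathcal S\in\mathcal H^2[a,b]\otimes\mathcal H^2[c,d]$ (the continuous functions on $Q$ all of whose weak derivatives $\partial_x^i\partial_y^j\mathcal S$, $0\le i,j\le 2$, are in $L^2(Q)$) that have finite variation on $Q$ in the sense of Hardy and Krause, and for $V\ge 0$ let $\mathbf S_V$ be the class of those $\mathcal S\in\mathbf S$ whose variation is at most $V$. Assume that $B_{x,1},\dots,B_{x,R}$ are linearly independent on the support of $h$, and $B_{y,1},\dots,B_{y,L}$ on the support of $g$. Then: 1. almost surely, for all sufficiently large $m$ and for every data vector $\mathbf z\in\mathbb R^m$, the least-squares problem $\min_\Theta\sum_{j=1}^m (z_j-s(x_j,y_j,\Theta))^2$ has the unique solution $\mathrm{devec}\{(M^TM)^{-1}M^T\mathbf z\}$; and for every $\mathcal S\in\mathbf S$ the function $\mathcal S$ is square integrable with respect to $h\otimes g$, and there is a unique matrix $\Pi(\mathcal S)\in\mathbb R^{R\times L}$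 that minimizes $\Theta\mapsto\int(\mathcal S-s(\cdot,\Theta))^2\,d(h\otimes g)$; 2. almost surely, for every $V\ge 0$, $\ \sup_{\mathcal S\in\mathbf S_V}\|\widehat\Theta_m(\mathcal S)-\Pi(\mathcal S)\|\to 0$ as $m\to\infty$; 3. consequently, for almost all $\omega$ and all $\mathcal S\in\mathbf S$, $\ \|\widehat\Theta_m(\mathcal S)-\Pi(\mathcal S)\|\to 0$ as $m\to\infty$. Here $\|\cdot\|$ is the Frobenius norm. -/

import Mathlib

open MeasureTheory ProbabilityTheory Filter Topology Set
open scoped NNReal ENNReal Matrix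

attribute [local instance] Matrix.frobeniusNormedAddCommGroup

noncomputable section

/-- The `i`-th B-spline of degree `p` for the knots `t 0 ≤ t 1 ≤ …`, by the Cox-de Boor
recursion (the convention `0 / 0 = 0` for coinciding knots is Lean's division by zero).
The pieces are right-continuous, except at the right end `β` of the domain, where the value is the
limit from the left (the usual closure of the last knot interval). -/
def bspline (t : ℕ → ℝ) (β : ℝ) : ℕ → ℕ → ℝ → ℝ
  | 0, i, x =>
      open Classical in
      if (x ≠ β ∧ t i ≤ x ∧ x < t (i + 1)) ∨ (x = β ∧ t i < x ∧ x ≤ t (i + 1)) then 1 else 0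
  | p + 1, i, x =>
      (x - t i) / (t (i + p + 1) - t i) * bspline t β p i x
        + (t (i + p + 2) - x) / (t (i + p + 2) - t (i + 1)) * bspline t β p (i + 1) x

/-- `t 0, …, t (R + p)` is a knot vector for `R` B-splines of degree `p ≥ 1` on `[a, b]`: the knots
are nondecreasing, the basic interval `[t p, t R]` contains `[a, b]`, and the knots `t p, …, t R`
are simple, so that the splines have `p - 1` continuous derivatives inside. The outer
knots may coincide with the end points (clamped knots) or not. -/
structure IsKnotVector (t : ℕ → ℝ) (p R : ℕ) (a b : ℝ) : Prop where
  one_le_degree : 1 ≤ p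
  monotoneOn : MonotoneOn t (Iic (R + p))
  strictMonoOn : StrictMonoOn t (Icc p R)
  left_le : t p ≤ a
  le_right : b ≤ t R

/-- The B-spline basis of degree `p` with `R` elements. -/
def bsplineBasis (t : ℕ → ℝ) (p R : ℕ) : Fin R → ℝ → ℝ := fun r => bspline t (t R) p r

variable {R L m : ℕ}

/-- The tensor product spline `s(x, y, Θ) = ∑ r, ∑ l, Bx r x * By l y * Θ r l`. -/
def tensorSpline (Bx : Fin R → ℝ → ℝ) (By : Fin L → ℝ → ℝ) (Θ : Matrix (Fin R) (Fin L) ℝ)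
    (q : ℝ × ℝ) : ℝ :=
  ∑ r, ∑ l, Bx r q.1 * By l q.2 * Θ r l

/-- The `m × RL` design matrix, whose `j`-th row is `By (y j) ⊗ Bx (x j)`. -/
def designMatrix (Bx : Fin R → ℝ → ℝ) (By : Fin L → ℝ → ℝ) (x y : Fin m → ℝ) :
    Matrix (Fin m) (Fin L × Fin R) ℝ :=
  Matrix.of fun j k => By k.1 (y j) * Bx k.2 (x j)

/-- The least-squares coefficient matrix `devec ((Mᵀ M)⁻¹ Mᵀ z)`. -/
def lsCoeff (Bx : Fin R → ℝ → ℝ) (By : Fin L → ℝ → ℝ) (x y z : Fin m → ℝ) :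
    Matrix (Fin R) (Fin L) ℝ :=
  let M := designMatrix Bx By x y
  Matrix.of fun r l => ((Mᵀ * M)⁻¹ *ᵥ (Mᵀ *ᵥ z)) (l, r)

/-- The residual sum of squares of the coefficient matrix `Θ`. -/
def residualSS (Bx : Fin R → ℝ → ℝ) (By : Fin L → ℝ → ℝ) (x y z : Fin m → ℝ)
    (Θ : Matrix (Fin R) (Fin L) ℝ) : ℝ :=
  ∑ j, (z j - tensorSpline Bx By Θ (x j, y j)) ^ 2

/-- The squared distance `‖S - s(·, Θ)‖²` in `L²(ν)`. -/
def sqDist (ν : Measure (ℝ × ℝ)) (Bx : Fin R → ℝ → ℝ) (By : Fin L → ℝ → ℝ) (S : ℝ × ℝ → ℝ)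
    (Θ : Matrix (Fin R) (Fin L) ℝ) : ℝ :=
  ∫ q, (S q - tensorSpline Bx By Θ q) ^ 2 ∂ν

/-- The mixed partial derivative `∂ₓⁱ ∂ᵧʲ φ`. -/
def mixedDeriv (i j : ℕ) (φ : ℝ × ℝ → ℝ) (q : ℝ × ℝ) : ℝ :=
  iteratedDeriv i (fun s => iteratedDeriv j (fun t => φ (s, t)) q.2) q.1

/-- `w` is the weak mixed derivative `∂ₓⁱ ∂ᵧʲ S` on the open rectangle `(a, b) × (c, d)`. -/
def IsWeakMixedDeriv (a b c d : ℝ) (i j : ℕ) (S w : ℝ × ℝ → ℝ) : Prop :=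
  ∀ φ : ℝ × ℝ → ℝ, ContDiff ℝ (⊤ : ℕ∞) φ → HasCompactSupport φ → tsupport φ ⊆ Ioo a b ×ˢ Ioo c d →
    ∫ q in Icc a b ×ˢ Icc c d, S q * mixedDeriv i j φ q
      = (-1) ^ (i + j) * ∫ q in Icc a b ×ˢ Icc c d, w q * φ q

/-- Membership in `H²[a, b] ⊗ H²[c, d]` (Hilbert space tensor product): `S` is the continuous
representative of a function all of whose weak derivatives `∂ₓⁱ ∂ᵧʲ S` with `i, j ≤ 2`
are square integrable on the rectangle. Only the values of `S` on the rectangle matter. -/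
def MemTensorH2 (a b c d : ℝ) (S : ℝ × ℝ → ℝ) : Prop :=
  ContinuousOn S (Icc a b ×ˢ Icc c d) ∧
    ∀ i ≤ 2, ∀ j ≤ 2, ∃ w : ℝ × ℝ → ℝ,
      MemLp w 2 (volume.restrict (Icc a b ×ˢ Icc c d)) ∧ IsWeakMixedDeriv a b c d i j S w

/-- The Vitali variation of `S` on `[a, b] × [c, d]`: the supremum over all grids of
the sums of the absolute rectangular increments. -/
def vitaliVariation (a b c d : ℝ) (S : ℝ × ℝ → ℝ) : ℝ≥0∞ :=
  ⨆ (u : ℕ × {u : ℕ → ℝ // Monotone u ∧ ∀ i, u i ∈ Icc a b})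
    (v : ℕ × {v : ℕ → ℝ // Monotone v ∧ ∀ j, v j ∈ Icc c d}),
    ∑ i ∈ Finset.range u.1, ∑ j ∈ Finset.range v.1,
      ENNReal.ofReal |S (u.2.1 (i + 1), v.2.1 (j + 1)) - S (u.2.1 (i + 1), v.2.1 j)
        - S (u.2.1 i, v.2.1 (j + 1)) + S (u.2.1 i, v.2.1 j)|

/-- The Hardy-Krause variation of `S` on `[a, b] × [c, d]`: the Vitali variation plus the
variations of the restrictions to the two edges through the corner `(a, c)`. -/
def hkVariation (a b c d : ℝ) (S : ℝ × ℝ → ℝ) : ℝ≥0∞ :=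
  vitaliVariation a b c d S + eVariationOn (fun x => S (x, c)) (Icc a b)
    + eVariationOn (fun y => S (a, y)) (Icc c d)

/-- The space of surfaces in `H² ⊗ H²` that are of bounded variation on `[a, b] × [c, d]`. -/
def surfaceSpace (a b c d : ℝ) : Set (ℝ × ℝ → ℝ) :=
  {S | MemTensorH2 a b c d S ∧ hkVariation a b c d S < ∞}

/-- The surfaces in `H² ⊗ H²` whose variation on `[a, b] × [c, d]` is bounded by `V`. -/
def surfaceClass (a b c d : ℝ) (V : ℝ≥0) : Set (ℝ × ℝ → ℝ) :=
  {S | MemTensorH2 a b c d S ∧ hkVariation a b c d S ≤ V}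

end

/-!
Both coefficient matrices solve normal equations. With `W k` the tensor product B-splines and
`ν = h ⊗ g`, the least-squares coefficients are `Gₘ⁻¹ bₘ(S)`, where `Gₘ` is the matrix of the means
of `W k * W l` over the design points and `bₘ(S)` the vector of the means of `(S + e) * W k`; the
coefficients of the best `L²(ν)` approximation are `G⁻¹ b(S)` with the corresponding integrals.
The matrix `G` is positive definite: a spline that vanishes almost everywhere vanishes on the
support because B-splines are continuous on the basic interval, where the knots are simple
(`IsKnotVector.continuousOn_bspline`, `IsKnotVector.eq_zero_of_ae_eq_zero`, `posDef_gram`). So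
`Gₘ → G` almost surely by the strong law of large numbers, `Gₘ` is eventually invertible, and
`Gₘ⁻¹ → G⁻¹`. The strong law also removes the errors from `bₘ(S)`.

It remains to see that `bₘ(S) → b(S)` uniformly over surfaces of variation at most `V`. For surfaces
that vanish in the corner `(a, c)`, a weighted Koksma-Hlawka inequality
(`abs_empiricalError_mul_le`) bounds the difference by `V` times the largest integration error of
`W k` restricted to a quadrant `[u, ∞) × [v, ∞)`, and that error tends to zero almost surely by a
weighted Glivenko-Cantelli theorem (`ae_eventually_abs_empiricalError_quadrant_le`); `h` and `g` may
have atoms, so its proof uses finitely many brackets of small measure. The variation does not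
see the additive constant `S (a, c)`, which is unbounded over the class. But B-splines are a
partition of unity (`IsKnotVector.sum_bsplineBasis`), so a constant added to `S` is added to all
coefficients of both solutions and cancels in their difference (`tendsto_leastSquares_sub`).
-/

/-! ### B-splines on the basic interval -/

section Spline

lemma measurable_bspline (t : ℕ → ℝ) (β : ℝ) (k i : ℕ) : Measurable (bspline t β k i) := by
  induction k generalizing i with
  | zero =>
    change Measurable fun x => bspline t β 0 i x
    unfold bspline
    refine Measurable.ite ?_ measurable_const measurable_const
    simp only [ne_eq]
    measurability
  | succ k ih =>
    have h1 := ih i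
    have h2 := ih (i + 1)
    change Measurable fun x => bspline t β (k + 1) i x
    unfold bspline
    fun_prop

lemma exists_abs_bspline_le (t : ℕ → ℝ) (β : ℝ) (k i : ℕ) (a b : ℝ) :
    ∃ C, ∀ x ∈ Icc a b, |bspline t β k i x| ≤ C := by
  induction k generalizing i with
  | zero =>
    refine ⟨1, fun x _ => ?_⟩
    unfold bspline
    split_ifs <;> simp
  | succ k ih =>
    obtain ⟨C₁, h₁⟩ := ih i
    obtain ⟨C₂, h₂⟩ := ih (i + 1)
    obtain ⟨D₁, k₁⟩ := (isCompact_Icc (a := a) (b := b)).exists_bound_of_continuousOn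
      (f := fun x => (x - t i) / (t (i + k + 1) - t i)) (by fun_prop)
    obtain ⟨D₂, k₂⟩ := (isCompact_Icc (a := a) (b := b)).exists_bound_of_continuousOn
      (f := fun x => (t (i + k + 2) - x) / (t (i + k + 2) - t (i + 1))) (by fun_prop)
    refine ⟨D₁ * C₁ + D₂ * C₂, fun x hx => ?_⟩
    unfold bspline
    refine (abs_add_le _ _).trans ?_
    rw [abs_mul, abs_mul]
    have e₁ := k₁ x hx
    have e₂ := k₂ x hx
    rw [Real.norm_eq_abs] at e₁ e₂
    exact add_le_add (mul_le_mul e₁ (h₁ x hx) (abs_nonneg _) ((abs_nonneg _).trans e₁))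
      (mul_le_mul e₂ (h₂ x hx) (abs_nonneg _) ((abs_nonneg _).trans e₂))

variable {t : ℕ → ℝ} {p R : ℕ} {a b : ℝ}

lemma IsKnotVector.degree_lt (ht : IsKnotVector t p R a b) (hab : a < b) : p < R := by
  by_contra! hR
  have := ht.monotoneOn (show R ∈ Iic (R + p) by simp) (show p ∈ Iic (R + p) by simp) hR
  linarith [ht.left_le, ht.le_right]

lemma IsKnotVector.le_of_le (ht : IsKnotVector t p R a b) {i j : ℕ} (hij : i ≤ j)
    (hj : j ≤ R + p) : t i ≤ t j :=
  ht.monotoneOn (show i ∈ Iic (R + p) from hij.trans hj) hj hij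

/-- Every point of the basic interval lies in one of the cells cut out by its knots. -/
lemma IsKnotVector.exists_cell (ht : IsKnotVector t p R a b) (hab : a < b) {x : ℝ}
    (hx : x ∈ Icc (t p) (t R)) :
    ∃ μ, p ≤ μ ∧ μ < R ∧ bspline t (t R) 0 μ x = 1 := by
  have hpR := ht.degree_lt hab
  rcases hx.2.eq_or_lt with rfl | hlt
  · refine ⟨R - 1, by omega, by omega, ?_⟩
    have : t (R - 1) < t R := ht.strictMonoOn ⟨by omega, by omega⟩ ⟨by omega, le_rfl⟩ (by omega)
    have e : R - 1 + 1 = R := by omega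
    unfold bspline
    rw [if_pos]
    exact Or.inr ⟨rfl, this, by rw [e]⟩
  · classical
    have hex : ∃ n, p < n ∧ x < t n := ⟨R, hpR, hlt⟩
    obtain ⟨h1, h2⟩ := Nat.find_spec hex
    have hle : Nat.find hex ≤ R := Nat.find_min' hex ⟨hpR, hlt⟩
    obtain ⟨μ, hμ⟩ : ∃ μ, Nat.find hex = μ + 1 := ⟨Nat.find hex - 1, by omega⟩
    have hmin := Nat.find_min hex (m := μ) (by omega)
    rw [hμ] at h1 h2 hle
    refine ⟨μ, by omega, by omega, ?_⟩
    unfold bspline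
    rw [if_pos]
    refine Or.inl ⟨hlt.ne, ?_, h2⟩
    rcases (show p ≤ μ by omega).eq_or_lt with rfl | hlt'
    · exact hx.1
    · by_contra! hcon
      exact hmin ⟨hlt', hcon⟩

/-- Local support: on the `μ`-th cell, a B-spline vanishes unless it sits over that cell. -/
lemma IsKnotVector.bspline_eq_zero (ht : IsKnotVector t p R a b) {x : ℝ} {μ : ℕ} (hμ : μ < R + p)
    (hx : bspline t (t R) 0 μ x = 1) {k i : ℕ} (hik : i + k < R + p)
    (h : ¬ (i ≤ μ ∧ μ ≤ i + k)) : bspline t (t R) k i x = 0 := by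
  induction k generalizing i with
  | zero =>
    have hx' : (x ≠ t R ∧ t μ ≤ x ∧ x < t (μ + 1)) ∨ (x = t R ∧ t μ < x ∧ x ≤ t (μ + 1)) := by
      by_contra hcon
      unfold bspline at hx
      rw [if_neg hcon] at hx
      norm_num at hx
    unfold bspline
    rw [if_neg]
    rcases (show i + 1 ≤ μ ∨ μ + 1 ≤ i by omega) with h' | h'
    · have := ht.le_of_le h' (by omega)
      rintro (⟨h1, h2, h3⟩ | ⟨h1, h2, h3⟩) <;> rcases hx' with ⟨g1, g2, g3⟩ | ⟨g1, g2, g3⟩ <;>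
        first | exact h1 g1 | exact g1 h1 | linarith
    · have := ht.le_of_le h' (by omega)
      rintro (⟨h1, h2, h3⟩ | ⟨h1, h2, h3⟩) <;> rcases hx' with ⟨g1, g2, g3⟩ | ⟨g1, g2, g3⟩ <;>
        first | exact h1 g1 | exact g1 h1 | linarith
  | succ k ih =>
    unfold bspline
    rw [ih (by omega) (by omega), ih (by omega) (by omega)]
    simp

/-- All B-splines of degree `k ≤ p` that the knots allow sum to `1` on the basic interval: in the
recursion the two weights of each B-spline of the lower degree add up to `1`, and the
B-splines at both ends, which occur once only, vanish on the basic interval. -/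
lemma IsKnotVector.sum_range_bspline (ht : IsKnotVector t p R a b) (hab : a < b) {x : ℝ}
    (hx : x ∈ Icc (t p) (t R)) {k : ℕ} (hk : k ≤ p) {n : ℕ} (hn : n + k = R + p) :
    ∑ i ∈ Finset.range n, bspline t (t R) k i x = 1 := by
  obtain ⟨μ, hpμ, hμR, hμ⟩ := ht.exists_cell hab hx
  induction k generalizing n with
  | zero =>
    rw [Finset.sum_eq_single μ, hμ]
    · intro i hi hne
      rw [Finset.mem_range] at hi
      exact ht.bspline_eq_zero (by omega) hμ (by omega) (by omega)
    · intro h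
      exact absurd (Finset.mem_range.2 (by omega)) h
  | succ k ih =>
    rw [← ih (by omega) (n := n + 1) (by omega)]
    set ω : ℕ → ℝ := fun i => (x - t i) / (t (i + k + 1) - t i) * bspline t (t R) k i x with hω
    set c : ℕ → ℝ := fun i => (t (i + k + 1) - x) / (t (i + k + 1) - t i) * bspline t (t R) k i x
      with hc
    have e1 : ∀ i, bspline t (t R) (k + 1) i x = ω i + c (i + 1) := fun i => by
      rw [hω, hc]
      simp only [bspline]
      rw [show i + 1 + k + 1 = i + k + 2 by ring]
    have e2 : ∀ i ∈ Finset.range (n + 1), bspline t (t R) k i x = ω i + c i := fun i hi => by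
      rw [Finset.mem_range] at hi
      by_cases h : i ≤ μ ∧ μ ≤ i + k
      · have h1 : t i ≤ t μ := ht.le_of_le h.1 (by omega)
        have h2 : t μ < t (μ + 1) :=
          ht.strictMonoOn ⟨by omega, by omega⟩ ⟨by omega, by omega⟩ (by omega)
        have h3 : t (μ + 1) ≤ t (i + k + 1) := ht.le_of_le (by omega) (by omega)
        have : t (i + k + 1) - t i ≠ 0 := by
          apply ne_of_gt
          linarith
        simp only [hω, hc]
        field_simp
        ring
      · simp only [hω, hc, ht.bspline_eq_zero (by omega) hμ (show i + k < R + p by omega) h]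
        simp
    have z1 : ω n = 0 := by
      simp only [hω, ht.bspline_eq_zero (by omega) hμ (show n + k < R + p by omega) (by omega),
        mul_zero]
    have z2 : c 0 = 0 := by
      simp only [hc, ht.bspline_eq_zero (by omega) hμ (show 0 + k < R + p by omega) (by omega),
        mul_zero]
    rw [Finset.sum_congr rfl e2, Finset.sum_congr rfl fun i _ => e1 i, Finset.sum_add_distrib,
      Finset.sum_add_distrib, Finset.sum_range_succ ω, Finset.sum_range_succ' c, z1, z2]
    ring

lemma IsKnotVector.sum_bsplineBasis (ht : IsKnotVector t p R a b) (hab : a < b) {x : ℝ}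
    (hx : x ∈ Icc a b) : ∑ r, bsplineBasis t p R r x = 1 := by
  rw [← ht.sum_range_bspline hab ⟨ht.left_le.trans hx.1, hx.2.trans ht.le_right⟩ le_rfl rfl,
    Finset.sum_range]
  rfl

/-- The hat function with nodes `A ≤ B ≤ C`, put together from half-open pieces as in the
Cox-de Boor recursion, is continuous on `[α, β]` as long as nodes coincide outside `(α, β)` only. -/
lemma continuousOn_hat {A B C α β : ℝ} (hαβ : α < β) (hAB : A ≤ B) (hBC : B ≤ C)
    (h1 : A = B → B ≤ α ∨ β ≤ A) (h2 : B = C → C ≤ α ∨ β ≤ B) (χ₁ χ₂ : ℝ → ℝ)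
    (h₁ : ∀ x, (((x ≠ β ∧ A ≤ x ∧ x < B) ∨ (x = β ∧ A < x ∧ x ≤ B)) ∧ χ₁ x = 1) ∨
      (¬ ((x ≠ β ∧ A ≤ x ∧ x < B) ∨ (x = β ∧ A < x ∧ x ≤ B)) ∧ χ₁ x = 0))
    (h₂ : ∀ x, (((x ≠ β ∧ B ≤ x ∧ x < C) ∨ (x = β ∧ B < x ∧ x ≤ C)) ∧ χ₂ x = 1) ∨
      (¬ ((x ≠ β ∧ B ≤ x ∧ x < C) ∨ (x = β ∧ B < x ∧ x ≤ C)) ∧ χ₂ x = 0)) :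
    ContinuousOn (fun x => (x - A) / (B - A) * χ₁ x + (C - x) / (C - B) * χ₂ x) (Icc α β) := by
  rcases hAB.eq_or_lt with hAB' | hAB' <;> rcases hBC.eq_or_lt with hBC' | hBC'
  · subst hAB' hBC'
    simp only [sub_self, div_zero, zero_mul, add_zero]
    exact continuousOn_const
  · subst hAB'
    simp only [sub_self, div_zero, zero_mul, zero_add]
    rcases h1 rfl with h | h
    · refine ContinuousOn.congr (f := fun x => max 0 ((C - x) / (C - A))) (by fun_prop) ?_
      intro x hx
      have : 0 < C - A := sub_pos.2 hBC'
      dsimp only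
      rcases h₂ x with ⟨hc, e⟩ | ⟨hc, e⟩
      · rw [e, max_eq_right, mul_one]
        apply div_nonneg _ this.le
        rcases hc with hc | hc <;> linarith
      · have hCx : C ≤ x := by
          by_contra! hlt
          apply hc
          by_cases hxβ : x = β
          · right; exact ⟨hxβ, by linarith, hlt.le⟩
          · left; exact ⟨hxβ, by linarith [hx.1], hlt⟩
        rw [e, max_eq_left, mul_zero]
        exact div_nonpos_of_nonpos_of_nonneg (by linarith) this.le
    · refine ContinuousOn.congr (f := fun x => 0) (by fun_prop) ?_
      intro x hx
      dsimp only
      rcases h₂ x with ⟨hc, e⟩ | ⟨hc, e⟩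
      · rcases hc with hc | hc
        · exact absurd (le_antisymm hx.2 (by linarith)) hc.1
        · linarith
      · rw [e, mul_zero]
  · subst hBC'
    simp only [sub_self, div_zero, zero_mul, add_zero]
    rcases h2 rfl with h | h
    · refine ContinuousOn.congr (f := fun x => 0) (by fun_prop) ?_
      intro x hx
      dsimp only
      rcases h₁ x with ⟨hc, e⟩ | ⟨hc, e⟩
      · rcases hc with hc | hc <;> linarith [hx.1]
      · rw [e, mul_zero]
    · refine ContinuousOn.congr (f := fun x => max 0 ((x - A) / (B - A))) (by fun_prop) ?_
      intro x hx
      have : 0 < B - A := sub_pos.2 hAB'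
      dsimp only
      rcases h₁ x with ⟨hc, e⟩ | ⟨hc, e⟩
      · rw [e, max_eq_right, mul_one]
        apply div_nonneg _ this.le
        rcases hc with hc | hc <;> linarith
      · have hCx : x ≤ A := by
          by_contra! hlt
          apply hc
          by_cases hxβ : x = β
          · right; exact ⟨hxβ, hlt, by linarith⟩
          · left; exact ⟨hxβ, hlt.le, (lt_of_le_of_ne hx.2 hxβ).trans_le h⟩
        rw [e, max_eq_left, mul_zero]
        exact div_nonpos_of_nonpos_of_nonneg (by linarith) this.le
  · refine ContinuousOn.congr
      (f := fun x => max 0 (min ((x - A) / (B - A)) ((C - x) / (C - B)))) (by fun_prop) ?_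
    intro x hx
    have d1 : 0 < B - A := sub_pos.2 hAB'
    have d2 : 0 < C - B := sub_pos.2 hBC'
    dsimp only
    have hmin : x ≤ B → min ((x - A) / (B - A)) ((C - x) / (C - B)) = (x - A) / (B - A) := by
      intro h
      rw [min_eq_left_iff, div_le_div_iff₀ d1 d2]
      nlinarith [mul_nonneg (sub_nonneg.2 h) (show 0 ≤ C - A by linarith)]
    have hmin' : B ≤ x → min ((x - A) / (B - A)) ((C - x) / (C - B)) = (C - x) / (C - B) := by
      intro h
      rw [min_eq_right_iff, div_le_div_iff₀ d2 d1]
      nlinarith [mul_nonneg (sub_nonneg.2 h) (show 0 ≤ C - A by linarith)]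
    rcases h₁ x with ⟨hc, e⟩ | ⟨hc, e⟩ <;> rcases h₂ x with ⟨hc', e'⟩ | ⟨hc', e'⟩
    · rcases hc with hc | hc <;> rcases hc' with hc' | hc' <;>
        first | exact absurd hc.1 hc'.1 | exact absurd hc'.1 hc.1 | linarith
    · have hA : A ≤ x ∧ x ≤ B := by
        rcases hc with hc | hc <;> constructor <;> linarith
      rw [e, e', hmin hA.2, max_eq_right (div_nonneg (by linarith) d1.le)]
      ring
    · have hA : B ≤ x ∧ x ≤ C := by
        rcases hc' with hc | hc <;> constructor <;> linarith
      rw [e, e', hmin' hA.1, max_eq_right (div_nonneg (by linarith) d2.le)]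
      ring
    · rw [e, e', mul_zero, mul_zero, add_zero, eq_comm, max_eq_left_iff]
      rcases le_or_gt x A with hxA | hxA
      · exact (min_le_left _ _).trans (div_nonpos_of_nonpos_of_nonneg (by linarith) d1.le)
      rcases le_or_gt C x with hxC | hxC
      · exact (min_le_right _ _).trans (div_nonpos_of_nonpos_of_nonneg (by linarith) d2.le)
      exfalso
      by_cases hxβ : x = β <;> rcases lt_trichotomy x B with hB | hB | hB
      · exact hc (Or.inr ⟨hxβ, hxA, hB.le⟩)
      · exact hc (Or.inr ⟨hxβ, hxA, hB.le⟩)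
      · exact hc' (Or.inr ⟨hxβ, hB, hxC.le⟩)
      · exact hc (Or.inl ⟨hxβ, hxA.le, hB⟩)
      · exact hc' (Or.inl ⟨hxβ, hB.ge, hxC⟩)
      · exact hc' (Or.inl ⟨hxβ, hB.le, hxC⟩)

/-- Continuity holds up to and including the end points of the basic interval: right-continuity at
`t p` and the left limit as value at `t R` make outer knots irrelevant, coinciding or not. -/
lemma IsKnotVector.continuousOn_bspline (ht : IsKnotVector t p R a b) (hab : a < b) {k i : ℕ}
    (hk : 1 ≤ k) (hik : i + k < R + p) :
    ContinuousOn (bspline t (t R) k i) (Icc (t p) (t R)) := by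
  have hpR := ht.degree_lt hab
  induction k, hk using Nat.le_induction generalizing i with
  | base =>
    have hχ : ∀ i x, (((x ≠ t R ∧ t i ≤ x ∧ x < t (i + 1)) ∨
        (x = t R ∧ t i < x ∧ x ≤ t (i + 1))) ∧ bspline t (t R) 0 i x = 1) ∨
        (¬ ((x ≠ t R ∧ t i ≤ x ∧ x < t (i + 1)) ∨ (x = t R ∧ t i < x ∧ x ≤ t (i + 1))) ∧
          bspline t (t R) 0 i x = 0) := fun i x => by
      unfold bspline
      split_ifs with h
      · exact Or.inl ⟨h, rfl⟩
      · exact Or.inr ⟨h, rfl⟩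
    have hnode : ∀ j, j + 1 ≤ R + p → t j = t (j + 1) → t (j + 1) ≤ t p ∨ t R ≤ t j := by
      intro j hj he
      rcases (show j + 1 ≤ p ∨ (p ≤ j ∧ j + 1 ≤ R) ∨ R ≤ j by omega) with h | h | h
      · exact Or.inl (ht.le_of_le h (by omega))
      · exact absurd he (ht.strictMonoOn ⟨h.1, by omega⟩ ⟨by omega, h.2⟩ (by omega)).ne
      · exact Or.inr (ht.le_of_le h (by omega))
    exact continuousOn_hat (ht.strictMonoOn ⟨le_rfl, hpR.le⟩ ⟨hpR.le, le_rfl⟩ hpR)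
      (ht.le_of_le (by omega) (by omega)) (ht.le_of_le (by omega) (by omega))
      (hnode i (by omega)) (hnode (i + 1) (by omega)) _ _ (hχ i) (hχ (i + 1))
  | succ k hk ih =>
    have e1 := ih (i := i) (by omega)
    have e2 := ih (i := i + 1) (by omega)
    change ContinuousOn (fun x => bspline t (t R) (k + 1) i x) _
    unfold bspline
    fun_prop

lemma IsKnotVector.continuousOn_bsplineBasis (ht : IsKnotVector t p R a b) (hab : a < b)
    (r : Fin R) : ContinuousOn (bsplineBasis t p R r) (Icc a b) :=
  (ht.continuousOn_bspline hab ht.one_le_degree (by have := r.2; omega)).mono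
    (Icc_subset_Icc ht.left_le ht.le_right)

/-- A spline that vanishes almost everywhere vanishes on the support, by continuity. -/
lemma IsKnotVector.eq_zero_of_ae_eq_zero (ht : IsKnotVector t p R a b) (hab : a < b)
    {h : Measure ℝ} (hh : h (Icc a b)ᶜ = 0)
    (hB : LinearIndependent ℝ (fun r : Fin R => h.support.domRestrict (bsplineBasis t p R r)))
    {c : Fin R → ℝ} (hc : ∀ᵐ x ∂h, ∑ r, c r * bsplineBasis t p R r x = 0) (r : Fin R) :
    c r = 0 := by
  have hsupp : h.support ⊆ Icc a b :=
    Measure.support_subset_of_isClosed isClosed_Icc (by rwa [mem_ae_iff])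
  refine Fintype.linearIndependent_iff.1 hB c ?_ r
  ext ⟨x, hx⟩
  simp only [Finset.sum_apply, Pi.smul_apply, Set.domRestrict_apply, smul_eq_mul, Pi.zero_apply]
  by_contra hne
  have hcont : ContinuousOn (fun x => ∑ r, c r * bsplineBasis t p R r x) (Icc a b) :=
    continuousOn_finsetSum _ fun r _ => continuousOn_const.mul (ht.continuousOn_bsplineBasis hab r)
  have hev := (hcont x (hsupp hx)).eventually_ne hne
  rw [eventually_nhdsWithin_iff] at hev
  have hpos := (Measure.mem_support_iff_forall x).1 hx _ hev
  refine hpos.ne' ?_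
  rw [← nonpos_iff_eq_zero, ← show h ({y | ∑ r, c r * bsplineBasis t p R r y = 0}ᶜ ∪
    (Icc a b)ᶜ) = 0 from measure_union_null hc hh]
  refine measure_mono fun y hy => ?_
  by_cases hy' : y ∈ Icc a b
  · exact Or.inl (hy hy')
  · exact Or.inr hy'

end Spline

/-! ### Uniform laws of large numbers for quadrants -/

section Empirical

variable {Ω E : Type*} [MeasurableSpace Ω] [MeasurableSpace E] {P : Measure Ω}

/-- The error of the mean over the first `m` points `z 0, …, z (m - 1)` as an approximation of the
integral of `f` against `ν`. -/
noncomputable def empiricalError (ν : Measure E) (z : ℕ → E) (m : ℕ) (f : E → ℝ) : ℝ :=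
  (∑ j ∈ Finset.range m, f (z j)) / m - ∫ q, f q ∂ν

lemma empiricalError_add {ν : Measure E} {f₁ f₂ : E → ℝ} (h₁ : Integrable f₁ ν)
    (h₂ : Integrable f₂ ν) (z : ℕ → E) (m : ℕ) :
    empiricalError ν z m (fun q => f₁ q + f₂ q)
      = empiricalError ν z m f₁ + empiricalError ν z m f₂ := by
  unfold empiricalError
  rw [integral_add h₁ h₂, Finset.sum_add_distrib]
  ring

lemma empiricalError_sum {ν : Measure E} {ι : Type*} (s : Finset ι) (c : ι → ℝ) {f : ι → E → ℝ}
    (hf : ∀ i ∈ s, Integrable (f i) ν) (z : ℕ → E) (m : ℕ) :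
    empiricalError ν z m (fun q => ∑ i ∈ s, c i * f i q)
      = ∑ i ∈ s, c i * empiricalError ν z m (f i) := by
  unfold empiricalError
  rw [integral_finsetSum s fun i hi => (hf i hi).const_mul _, Finset.sum_comm, Finset.sum_div,
    ← Finset.sum_sub_distrib]
  refine Finset.sum_congr rfl fun i _ => ?_
  rw [integral_const_mul, ← Finset.mul_sum]
  ring

lemma abs_sum_div_le {m : ℕ} {f : ℕ → ℝ} {η : ℝ} (hη : 0 ≤ η) (h : ∀ j, |f j| ≤ η) :
    |(∑ j ∈ Finset.range m, f j) / m| ≤ η := by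
  rw [abs_div, Nat.abs_cast]
  refine div_le_of_le_mul₀ (by positivity) hη ?_
  refine (Finset.abs_sum_le_sum_abs _ _).trans ((Finset.sum_le_sum fun j _ => h j).trans ?_)
  rw [Finset.sum_const, Finset.card_range, nsmul_eq_mul, mul_comm]

lemma abs_empiricalError_sub_le {ν : Measure E} [IsProbabilityMeasure ν] {f₁ f₂ : E → ℝ}
    (h₁ : Integrable f₁ ν) (h₂ : Integrable f₂ ν) {Q : Set E} (hν : ∀ᵐ q ∂ν, q ∈ Q) {z : ℕ → E}
    (hz : ∀ j, z j ∈ Q) {η : ℝ} (hη : 0 ≤ η) (h : ∀ q ∈ Q, |f₁ q - f₂ q| ≤ η) (m : ℕ) :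
    |empiricalError ν z m f₁ - empiricalError ν z m f₂| ≤ 2 * η := by
  have e : empiricalError ν z m f₁ - empiricalError ν z m f₂
      = (∑ j ∈ Finset.range m, (f₁ (z j) - f₂ (z j))) / m - ∫ q, (f₁ q - f₂ q) ∂ν := by
    unfold empiricalError
    rw [integral_sub h₁ h₂, Finset.sum_sub_distrib]
    ring
  rw [e, two_mul]
  refine (abs_sub _ _).trans (add_le_add (abs_sum_div_le hη fun j => h _ (hz j)) ?_)
  have := norm_integral_le_of_norm_le_const (μ := ν) (f := fun q => f₁ q - f₂ q) (C := η)
    (by filter_upwards [hν] with q hq using h q hq)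
  simpa using this

/-- The strong law of large numbers for a function of pairwise independent observations. -/
lemma ae_tendsto_empiricalError {ν : Measure E} {Z : ℕ → Ω → E} (hZ : ∀ j, Measurable (Z j))
    (hlaw : ∀ j, P.map (Z j) = ν) (hind : Pairwise fun i j => IndepFun (Z i) (Z j) P)
    {f : E → ℝ} (hf : Measurable f) (hint : Integrable f ν) :
    ∀ᵐ ω ∂P, Tendsto (fun m => empiricalError ν (fun j => Z j ω) m f) atTop (𝓝 0) := by
  have hi : Integrable (fun ω => f (Z 0 ω)) P := by
    rw [← hlaw 0] at hint
    exact hint.comp_measurable (hZ 0)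
  have := strong_law_ae_real (fun j ω => f (Z j ω)) hi
    (fun i j hij => (hind hij).comp hf hf)
    (fun j => (IdentDistrib.mk (hZ j).aemeasurable (hZ 0).aemeasurable
      ((hlaw j).trans (hlaw 0).symm)).comp hf)
  filter_upwards [this] with ω hω
  have e : ∫ ω, f (Z 0 ω) ∂P = ∫ q, f q ∂ν := by
    rw [← hlaw 0, integral_map (hZ 0).aemeasurable hf.aestronglyMeasurable]
  rw [e] at hω
  simpa [empiricalError] using hω.sub_const (∫ q, f q ∂ν)

/-- Sets caught in one small bracket `A ⊆ D ⊆ B` obey a uniform law of large numbers, up to an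
error of the order of the measure of the bracket. -/
lemma ae_eventually_abs_empiricalError_le_of_bracket {ν : Measure E} [IsProbabilityMeasure ν]
    {Z : ℕ → Ω → E} (hZ : ∀ j, Measurable (Z j)) (hlaw : ∀ j, P.map (Z j) = ν)
    (hind : Pairwise fun i j => IndepFun (Z i) (Z j) P) {W : E → ℝ} (hW : Measurable W) {C : ℝ}
    (hC : ∀ q, |W q| ≤ C) {A B : Set E} (hA : MeasurableSet A) (hB : MeasurableSet B) {ε : ℝ}
    (hε : 0 < ε) (hAB : ν.real (B \ A) * C ≤ ε) :
    ∀ᵐ ω ∂P, ∀ᶠ m in atTop, ∀ D, MeasurableSet D → A ⊆ D → D ⊆ B →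
      |empiricalError ν (fun j => Z j ω) m (D.indicator W)| ≤ 4 * ε := by
  have hWint : Integrable W ν :=
    Integrable.of_bound hW.aestronglyMeasurable C (Eventually.of_forall hC)
  have hw : Integrable ((B \ A).indicator fun q => |W q|) ν := hWint.abs.indicator (hB.diff hA)
  have hwε : ∫ q, (B \ A).indicator (fun q => |W q|) q ∂ν ≤ ε := by
    rw [integral_indicator (hB.diff hA)]
    refine (integral_mono hWint.abs.restrict (integrable_const C) hC).trans ?_
    simpa using hAB
  have hdiff : ∀ D, A ⊆ D → D ⊆ B → ∀ q,
      |D.indicator W q - A.indicator W q| ≤ (B \ A).indicator (fun q => |W q|) q := by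
    intro D h1 h2 q
    by_cases hqA : q ∈ A
    · simp [hqA, h1 hqA]
    · by_cases hqD : q ∈ D
      · simp [hqA, hqD, h2 hqD]
      · simp only [indicator_of_notMem hqA, indicator_of_notMem hqD, sub_self, abs_zero]
        exact indicator_nonneg (fun _ _ => abs_nonneg _) _
  filter_upwards [ae_tendsto_empiricalError hZ hlaw hind (hW.indicator hA) (hWint.indicator hA),
    ae_tendsto_empiricalError hZ hlaw hind
      ((continuous_abs.measurable.comp hW).indicator (hB.diff hA)) hw] with ω h1 h2
  filter_upwards [h1.abs.eventually_lt_const (u := ε) (by simpa using hε),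
    h2.eventually_lt_const hε] with m g1 g2 D hD hAD hDB
  have k1 : |(∑ j ∈ Finset.range m, D.indicator W (Z j ω)) / m
      - (∑ j ∈ Finset.range m, A.indicator W (Z j ω)) / m|
      ≤ (∑ j ∈ Finset.range m, (B \ A).indicator (fun q => |W q|) (Z j ω)) / m := by
    rw [← sub_div, ← Finset.sum_sub_distrib, abs_div, Nat.abs_cast]
    gcongr
    exact (Finset.abs_sum_le_sum_abs _ _).trans (Finset.sum_le_sum fun j _ => hdiff D hAD hDB _)
  have k2 : |∫ q, D.indicator W q ∂ν - ∫ q, A.indicator W q ∂ν|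
      ≤ ∫ q, (B \ A).indicator (fun q => |W q|) q ∂ν := by
    rw [← integral_sub (hWint.indicator hD) (hWint.indicator hA)]
    exact norm_integral_le_of_norm_le (f := fun q => D.indicator W q - A.indicator W q) hw
      (Eventually.of_forall (hdiff D hAD hDB))
  unfold empiricalError at *
  simp only [Function.comp_def] at g2
  rw [abs_le] at *
  rw [abs_lt] at g1
  constructor <;> linarith [g1.1, g1.2, k1.1, k1.2, k2.1, k2.2]

/-- Finitely many brackets of small measure catch all half-lines `[u, ∞)` with `u` in a compact
interval. Near `u₀` two brackets do: one for `u ≤ u₀`, which leaves out a possible atom at `u₀`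
since both of its ends contain `u₀`, and one for `u > u₀`. -/
lemma exists_finite_brackets_Ici (h : Measure ℝ) [IsFiniteMeasure h] (a b : ℝ) {ε : ℝ≥0∞}
    (hε : 0 < ε) :
    ∃ 𝓑 : Set (Set ℝ × Set ℝ), 𝓑.Finite ∧
      (∀ I ∈ 𝓑, MeasurableSet I.1 ∧ MeasurableSet I.2 ∧ h (I.2 \ I.1) ≤ ε) ∧
      ∀ u ∈ Icc a b, ∃ I ∈ 𝓑, I.1 ⊆ Ici u ∧ Ici u ⊆ I.2 := by
  refine (isCompact_Icc (a := a) (b := b)).induction_on (p := fun s =>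
    ∃ 𝓑 : Set (Set ℝ × Set ℝ), 𝓑.Finite ∧
      (∀ I ∈ 𝓑, MeasurableSet I.1 ∧ MeasurableSet I.2 ∧ h (I.2 \ I.1) ≤ ε) ∧
      ∀ u ∈ s, ∃ I ∈ 𝓑, I.1 ⊆ Ici u ∧ Ici u ⊆ I.2) ⟨∅, by simp⟩ ?_ ?_ ?_
  · rintro s t hst ⟨𝓑, h1, h2, h3⟩
    exact ⟨𝓑, h1, h2, fun u hu => h3 u (hst hu)⟩
  · rintro s t ⟨𝓑, h1, h2, h3⟩ ⟨𝓑', h1', h2', h3'⟩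
    refine ⟨𝓑 ∪ 𝓑', h1.union h1', fun I hI => hI.elim (h2 I) (h2' I), fun u hu => ?_⟩
    rcases hu with hu | hu
    · obtain ⟨I, hI, k⟩ := h3 u hu
      exact ⟨I, Or.inl hI, k⟩
    · obtain ⟨I, hI, k⟩ := h3' u hu
      exact ⟨I, Or.inr hI, k⟩
  · intro u₀ _
    have key : ∀ s : ℝ → Set ℝ, (∀ r, MeasurableSet (s r)) → Monotone s →
        (⋂ r > (0 : ℝ), s r) = ∅ → ∀ᶠ r in 𝓝[>] (0 : ℝ), h (s r) ≤ ε := by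
      intro s hs hm he
      have := tendsto_measure_biInter_gt (μ := h) (a := (0 : ℝ)) (s := s)
        (fun r _ => (hs r).nullMeasurableSet) (fun i j _ hij => hm hij)
        ⟨1, by norm_num, measure_ne_top _ _⟩
      rw [he, measure_empty] at this
      exact (this.eventually_lt_const hε).mono fun _ hr => hr.le
    have k1 := key (fun r => Ioo (u₀ - r) u₀) (fun r => measurableSet_Ioo)
      (fun r r' hr => Ioo_subset_Ioo_left (by linarith)) (by
        ext x
        simp only [mem_iInter, mem_Ioo, mem_empty_iff_false, iff_false]
        intro hx
        have := (hx 1 one_pos).2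
        linarith [(hx ((u₀ - x)) (by simp only [gt_iff_lt]; linarith)).1])
    have k2 := key (fun r => Ioo u₀ (u₀ + r)) (fun r => measurableSet_Ioo)
      (fun r r' hr => Ioo_subset_Ioo_right (by linarith)) (by
        ext x
        simp only [mem_iInter, mem_Ioo, mem_empty_iff_false, iff_false]
        intro hx
        have := (hx 1 one_pos).1
        linarith [(hx ((x - u₀)) (by simp only [gt_iff_lt]; linarith)).2])
    obtain ⟨r, ⟨hr1, hr2⟩, hr⟩ := ((k1.and k2).and self_mem_nhdsWithin).exists
    have hr : 0 < r := hr
    refine ⟨Ioo (u₀ - r) (u₀ + r), mem_nhdsWithin_of_mem_nhds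
      (Ioo_mem_nhds (by linarith) (by linarith)),
      {(Ici u₀, Ioi (u₀ - r)), (Ici (u₀ + r), Ioi u₀)}, by simp, ?_, ?_⟩
    · rintro I (rfl | rfl)
      · refine ⟨measurableSet_Ici, measurableSet_Ioi, (measure_mono ?_).trans hr1⟩
        rintro x ⟨hx1, hx2⟩
        exact ⟨hx1, not_le.1 hx2⟩
      · refine ⟨measurableSet_Ici, measurableSet_Ioi, (measure_mono ?_).trans hr2⟩
        rintro x ⟨hx1, hx2⟩
        exact ⟨hx1, not_le.1 hx2⟩
    · intro u hu
      rcases le_or_gt u u₀ with hu' | hu'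
      · exact ⟨_, Or.inl rfl, Ici_subset_Ici.2 hu', Ici_subset_Ioi.2 hu.1⟩
      · exact ⟨_, Or.inr rfl, Ici_subset_Ici.2 hu.2.le, Ici_subset_Ioi.2 hu'⟩

/-- A weighted Glivenko-Cantelli theorem for the quadrants `[u, ∞) × [v, ∞)` and a product law. -/
lemma ae_eventually_abs_empiricalError_quadrant_le {h g : Measure ℝ} [IsProbabilityMeasure h]
    [IsProbabilityMeasure g] {Z : ℕ → Ω → ℝ × ℝ} (hZ : ∀ j, Measurable (Z j))
    (hlaw : ∀ j, P.map (Z j) = h.prod g) (hind : Pairwise fun i j => IndepFun (Z i) (Z j) P)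
    {W : ℝ × ℝ → ℝ} (hW : Measurable W) {C : ℝ} (hC : ∀ q, |W q| ≤ C) (a b c d : ℝ) :
    ∀ᵐ ω ∂P, ∀ ε > 0, ∀ᶠ m in atTop, ∀ u ∈ Icc a b, ∀ v ∈ Icc c d,
      |empiricalError (h.prod g) (fun j => Z j ω) m ((Ici u ×ˢ Ici v).indicator W)| ≤ ε := by
  have hC0 : 0 ≤ C := (abs_nonneg _).trans (hC 0)
  have main : ∀ ε : ℝ, 0 < ε → ∀ᵐ ω ∂P, ∀ᶠ m in atTop, ∀ u ∈ Icc a b, ∀ v ∈ Icc c d,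
      |empiricalError (h.prod g) (fun j => Z j ω) m ((Ici u ×ˢ Ici v).indicator W)| ≤ ε := by
    intro ε hε
    set δ : ℝ := ε / 4 / (2 * (C + 1)) with hδ
    have hδ0 : 0 < δ := by positivity
    obtain ⟨𝓑, f1, m1, b1⟩ := exists_finite_brackets_Ici h a b (ENNReal.ofReal_pos.2 hδ0)
    obtain ⟨𝓒, f2, m2, b2⟩ := exists_finite_brackets_Ici g c d (ENNReal.ofReal_pos.2 hδ0)
    have hall : ∀ᵐ ω ∂P, ∀ I ∈ 𝓑, ∀ J ∈ 𝓒, ∀ᶠ m in atTop, ∀ D, MeasurableSet D →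
        I.1 ×ˢ J.1 ⊆ D → D ⊆ I.2 ×ˢ J.2 →
        |empiricalError (h.prod g) (fun j => Z j ω) m (D.indicator W)| ≤ 4 * (ε / 4) := by
      rw [ae_ball_iff f1.countable]
      intro I hI
      rw [ae_ball_iff f2.countable]
      intro J hJ
      obtain ⟨i1, i2, i3⟩ := m1 I hI
      obtain ⟨j1, j2, j3⟩ := m2 J hJ
      refine ae_eventually_abs_empiricalError_le_of_bracket hZ hlaw hind hW hC (i1.prod j1)
        (i2.prod j2) (by positivity) ?_
      have hsub : I.2 ×ˢ J.2 \ I.1 ×ˢ J.1 ⊆ (I.2 \ I.1) ×ˢ univ ∪ univ ×ˢ (J.2 \ J.1) := by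
        rintro ⟨x, y⟩ ⟨⟨hx, hy⟩, hxy⟩
        by_cases hx' : x ∈ I.1
        · exact Or.inr ⟨trivial, hy, fun hy' => hxy ⟨hx', hy'⟩⟩
        · exact Or.inl ⟨⟨hx, hx'⟩, trivial⟩
      have hle : (h.prod g) (I.2 ×ˢ J.2 \ I.1 ×ˢ J.1) ≤ ENNReal.ofReal (δ + δ) := by
        refine (measure_mono hsub).trans ((measure_union_le _ _).trans ?_)
        rw [Measure.prod_prod, Measure.prod_prod, measure_univ, measure_univ, mul_one, one_mul,
          ENNReal.ofReal_add hδ0.le hδ0.le]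
        exact add_le_add i3 j3
      have hle' : (h.prod g).real (I.2 ×ˢ J.2 \ I.1 ×ˢ J.1) ≤ δ + δ :=
        ENNReal.toReal_le_of_le_ofReal (by positivity) hle
      calc _ ≤ (δ + δ) * (C + 1) := by gcongr; linarith
        _ = ε / 4 := by rw [hδ]; field_simp; ring
    filter_upwards [hall] with ω hω
    have hω' : ∀ᶠ m in atTop, ∀ I ∈ 𝓑, ∀ J ∈ 𝓒, ∀ D, MeasurableSet D →
        I.1 ×ˢ J.1 ⊆ D → D ⊆ I.2 ×ˢ J.2 →
        |empiricalError (h.prod g) (fun j => Z j ω) m (D.indicator W)| ≤ 4 * (ε / 4) := by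
      rw [eventually_all_finite f1]
      intro I hI
      rw [eventually_all_finite f2]
      exact fun J hJ => hω I hI J hJ
    filter_upwards [hω'] with m hm u hu v hv
    obtain ⟨I, hI, hI1, hI2⟩ := b1 u hu
    obtain ⟨J, hJ, hJ1, hJ2⟩ := b2 v hv
    have := hm I hI J hJ (Ici u ×ˢ Ici v) (measurableSet_Ici.prod measurableSet_Ici)
      (prod_mono hI1 hJ1) (prod_mono hI2 hJ2)
    linarith
  have hall := ae_all_iff.2 fun n : ℕ => main (1 / ((n : ℝ) + 1)) Nat.one_div_pos_of_nat
  filter_upwards [hall] with ω hω ε hε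
  obtain ⟨n, hn⟩ := exists_nat_one_div_lt hε
  filter_upwards [hω n] with m hm u hu v hv
  exact (hm u hu v hv).trans hn.le

end Empirical

/-! ### A Koksma-Hlawka inequality -/

section KoksmaHlawka

/-- The `i`-th point of the partition of `[a, b]` into `n` equal parts, constant for `i ≥ n`. -/
noncomputable def gridPoint (a b : ℝ) (n i : ℕ) : ℝ := a + (b - a) * ((min i n : ℕ) / n)

lemma monotone_gridPoint {a b : ℝ} (hab : a ≤ b) (n : ℕ) : Monotone (gridPoint a b n) := by
  intro i j hij
  have : 0 ≤ b - a := sub_nonneg.2 hab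
  have h2 : min i n ≤ min j n := min_le_min_right n hij
  unfold gridPoint
  gcongr

lemma gridPoint_mem {a b : ℝ} (hab : a ≤ b) (n i : ℕ) : gridPoint a b n i ∈ Icc a b := by
  have h0 : 0 ≤ b - a := sub_nonneg.2 hab
  have h1 : ((min i n : ℕ) : ℝ) / n ≤ 1 := by
    refine div_le_one_of_le₀ ?_ (by positivity)
    exact_mod_cast min_le_right i n
  unfold gridPoint
  constructor
  · have : 0 ≤ (b - a) * (((min i n : ℕ) : ℝ) / n) := by positivity
    linarith
  · have := mul_le_mul_of_nonneg_left h1 h0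
    linarith

lemma gridPoint_zero (a b : ℝ) (n : ℕ) : gridPoint a b n 0 = a := by simp [gridPoint]

/-- Rounding down to the grid: the grid points from the first on that are `≤ x` are those up to the
`k`-th, and the `k`-th is close to `x`. -/
lemma exists_gridPoint_le {a b : ℝ} (hab : a < b) {n : ℕ} (hn : 0 < n) {x : ℝ}
    (hx : x ∈ Icc a b) : ∃ k ≤ n, |gridPoint a b n k - x| ≤ (b - a) / n ∧
      ∀ i < n, gridPoint a b n (i + 1) ≤ x ↔ i < k := by
  have h0 : 0 < b - a := sub_pos.2 hab
  have hn' : (0 : ℝ) < n := by exact_mod_cast hn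
  set y := (x - a) / (b - a) * n with hy
  have hxy : x = a + (b - a) * (y / n) := by rw [hy]; field_simp; ring
  have hy0 : 0 ≤ y := mul_nonneg (div_nonneg (by linarith [hx.1]) h0.le) hn'.le
  have hyn : y ≤ n := by
    rw [hy]
    refine mul_le_of_le_one_left hn'.le (div_le_one_of_le₀ (by linarith [hx.2]) h0.le)
  have hkn : ⌊y⌋₊ ≤ n := Nat.floor_le_of_le hyn
  refine ⟨⌊y⌋₊, hkn, ?_, fun i hi => ?_⟩
  · have e : gridPoint a b n ⌊y⌋₊ - x = -((b - a) / n * (y - ⌊y⌋₊)) := by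
      rw [gridPoint, min_eq_left hkn]
      conv_lhs => rw [hxy]
      ring
    have := Nat.floor_le hy0
    have := Nat.lt_floor_add_one y
    rw [e, abs_neg, abs_of_nonneg (mul_nonneg (by positivity) (by linarith))]
    exact mul_le_of_le_one_right (by positivity) (by linarith)
  · rw [gridPoint, min_eq_left (show i + 1 ≤ n by omega), ← Nat.succ_le_iff, Nat.le_floor_iff hy0]
    conv_lhs => rw [hxy]
    rw [add_le_add_iff_left, mul_le_mul_iff_right₀ h0, div_le_div_iff_of_pos_right hn']

lemma sum_range_ite_lt {n k : ℕ} (hk : k ≤ n) (f : ℕ → ℝ) :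
    ∑ i ∈ Finset.range n, (if i < k then f (i + 1) - f i else 0) = f k - f 0 := by
  rw [← Finset.sum_range_sub, ← Finset.sum_filter]
  congr 1
  ext i
  simp only [Finset.mem_filter, Finset.mem_range]
  omega

lemma ae_mem_rect {h g : Measure ℝ} [IsProbabilityMeasure h] [IsProbabilityMeasure g]
    {a b c d : ℝ} (hh : h (Icc a b)ᶜ = 0) (hg : g (Icc c d)ᶜ = 0) :
    ∀ᵐ q ∂(h.prod g), q ∈ Icc a b ×ˢ Icc c d := by
  rw [ae_iff]
  refine measure_mono_null (t := (Icc a b)ᶜ ×ˢ univ ∪ univ ×ˢ (Icc c d)ᶜ) ?_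
    (measure_union_null ?_ ?_)
  · rintro ⟨x, y⟩ hxy
    by_cases hx : x ∈ Icc a b
    · exact Or.inr ⟨trivial, fun hy => hxy ⟨hx, hy⟩⟩
    · exact Or.inl ⟨hx, trivial⟩
  · rw [Measure.prod_prod, hh, zero_mul]
  · rw [Measure.prod_prod, hg, mul_zero]

lemma integrable_of_continuousOn {ν : Measure (ℝ × ℝ)} [IsFiniteMeasure ν] {Q : Set (ℝ × ℝ)}
    (hQ : IsCompact Q) (hν : ∀ᵐ q ∂ν, q ∈ Q) {S : ℝ × ℝ → ℝ} (hS : ContinuousOn S Q) :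
    Integrable S ν := by
  have := hS.integrableOn_compact (μ := ν) hQ
  rwa [IntegrableOn, Measure.restrict_eq_self_of_ae_mem hν] at this

/-- The sums that bound the increments of `S` over two partitions. -/
lemma sum_abs_increments_le_of_hkVariation_le {a b c d : ℝ} {S : ℝ × ℝ → ℝ} {V : ℝ≥0}
    (hV : hkVariation a b c d S ≤ V) {u v : ℕ → ℝ} (hu : Monotone u) (hu' : ∀ i, u i ∈ Icc a b)
    (hv : Monotone v) (hv' : ∀ i, v i ∈ Icc c d) (n : ℕ) :
    ∑ i ∈ Finset.range n, ∑ j ∈ Finset.range n, |S (u (i + 1), v (j + 1)) - S (u (i + 1), v j)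
        - S (u i, v (j + 1)) + S (u i, v j)|
      + ∑ i ∈ Finset.range n, |S (u (i + 1), c) - S (u i, c)|
      + ∑ j ∈ Finset.range n, |S (a, v (j + 1)) - S (a, v j)| ≤ V := by
  have h1 : ENNReal.ofReal (∑ i ∈ Finset.range n, ∑ j ∈ Finset.range n,
      |S (u (i + 1), v (j + 1)) - S (u (i + 1), v j) - S (u i, v (j + 1)) + S (u i, v j)|)
      ≤ vitaliVariation a b c d S := by
    unfold vitaliVariation
    refine le_iSup₂_of_le (n, ⟨u, hu, hu'⟩) (n, ⟨v, hv, hv'⟩) ?_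
    rw [ENNReal.ofReal_sum_of_nonneg fun i _ => Finset.sum_nonneg fun j _ => abs_nonneg _]
    simp_rw [ENNReal.ofReal_sum_of_nonneg fun j _ => abs_nonneg _]
    exact le_rfl
  have h2 : ENNReal.ofReal (∑ i ∈ Finset.range n, |S (u (i + 1), c) - S (u i, c)|)
      ≤ eVariationOn (fun x => S (x, c)) (Icc a b) := by
    refine le_trans (le_of_eq ?_) (eVariationOn.sum_le (n := n) hu hu')
    rw [ENNReal.ofReal_sum_of_nonneg fun j _ => abs_nonneg _]
    simp_rw [edist_dist, Real.dist_eq]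
  have h3 : ENNReal.ofReal (∑ j ∈ Finset.range n, |S (a, v (j + 1)) - S (a, v j)|)
      ≤ eVariationOn (fun y => S (a, y)) (Icc c d) := by
    refine le_trans (le_of_eq ?_) (eVariationOn.sum_le (n := n) hv hv')
    rw [ENNReal.ofReal_sum_of_nonneg fun j _ => abs_nonneg _]
    simp_rw [edist_dist, Real.dist_eq]
  have h := (add_le_add (add_le_add h1 h2) h3).trans hV
  rw [← ENNReal.ofReal_add (by positivity) (by positivity),
    ← ENNReal.ofReal_add (by positivity) (by positivity), ← ENNReal.ofReal_coe_nnreal] at h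
  exact (ENNReal.ofReal_le_ofReal_iff V.2).1 h

/-- Summation by parts: the increments of `S` up to the grid point `(u k, v l)` below `(x, y)` add
up to the increment of `S` between `(a, c)` and that point. -/
lemma sum_increments_mul_quadrant (S W : ℝ × ℝ → ℝ) {u v : ℕ → ℝ} {a c x y : ℝ} (hu : u 0 = a)
    (hv : v 0 = c) (hx : a ≤ x) (hy : c ≤ y) {n k l : ℕ} (hk : k ≤ n) (hl : l ≤ n)
    (hux : ∀ i < n, u (i + 1) ≤ x ↔ i < k) (hvy : ∀ j < n, v (j + 1) ≤ y ↔ j < l) :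
    ∑ i ∈ Finset.range n, ∑ j ∈ Finset.range n,
        (S (u (i + 1), v (j + 1)) - S (u (i + 1), v j) - S (u i, v (j + 1)) + S (u i, v j))
          * (Ici (u (i + 1)) ×ˢ Ici (v (j + 1))).indicator W (x, y)
      + ∑ i ∈ Finset.range n, (S (u (i + 1), c) - S (u i, c))
          * (Ici (u (i + 1)) ×ˢ Ici c).indicator W (x, y)
      + ∑ j ∈ Finset.range n, (S (a, v (j + 1)) - S (a, v j))
          * (Ici a ×ˢ Ici (v (j + 1))).indicator W (x, y)
      = (S (u k, v l) - S (a, c)) * W (x, y) := by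
  have hχ : ∀ s t, (Ici s ×ˢ Ici t).indicator W (x, y)
      = (if s ≤ x then 1 else 0) * (if t ≤ y then 1 else 0) * W (x, y) := by
    intro s t
    rw [indicator_apply]
    by_cases h1 : s ≤ x <;> by_cases h2 : t ≤ y <;> simp [h1, h2]
  have e2 : ∑ i ∈ Finset.range n, (S (u (i + 1), c) - S (u i, c))
      * (Ici (u (i + 1)) ×ˢ Ici c).indicator W (x, y) = (S (u k, c) - S (a, c)) * W (x, y) := by
    rw [← hu, ← sum_range_ite_lt hk fun i => S (u i, c), Finset.sum_mul]
    refine Finset.sum_congr rfl fun i hi => ?_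
    rw [hχ, if_pos hy]
    simp only [hux i (Finset.mem_range.1 hi)]
    split_ifs <;> ring
  have e3 : ∑ j ∈ Finset.range n, (S (a, v (j + 1)) - S (a, v j))
      * (Ici a ×ˢ Ici (v (j + 1))).indicator W (x, y) = (S (a, v l) - S (a, c)) * W (x, y) := by
    rw [← hv, ← sum_range_ite_lt hl fun j => S (a, v j), Finset.sum_mul]
    refine Finset.sum_congr rfl fun j hj => ?_
    rw [hχ, if_pos hx]
    simp only [hvy j (Finset.mem_range.1 hj)]
    split_ifs <;> ring
  have e1 : ∑ i ∈ Finset.range n, ∑ j ∈ Finset.range n,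
        (S (u (i + 1), v (j + 1)) - S (u (i + 1), v j) - S (u i, v (j + 1)) + S (u i, v j))
          * (Ici (u (i + 1)) ×ˢ Ici (v (j + 1))).indicator W (x, y)
      = (S (u k, v l) - S (u k, c) - (S (a, v l) - S (a, c))) * W (x, y) := by
    have inner : ∀ s, S (s, v l) - S (s, c)
        = ∑ j ∈ Finset.range n, if j < l then S (s, v (j + 1)) - S (s, v j) else 0 := by
      intro s
      rw [sum_range_ite_lt hl fun j => S (s, v j), hv]
    rw [← hu, ← sum_range_ite_lt hk fun i => S (u i, v l) - S (u i, c), Finset.sum_mul]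
    refine Finset.sum_congr rfl fun i hi => ?_
    rw [inner, inner, ← Finset.sum_sub_distrib]
    by_cases hik : i < k
    · rw [if_pos hik, Finset.sum_mul]
      refine Finset.sum_congr rfl fun j hj => ?_
      rw [hχ]
      simp only [hux i (Finset.mem_range.1 hi), hvy j (Finset.mem_range.1 hj), if_pos hik]
      split_ifs <;> ring
    · rw [if_neg hik, zero_mul]
      refine Finset.sum_eq_zero fun j _ => ?_
      rw [hχ]
      simp only [hux i (Finset.mem_range.1 hi), if_neg hik]
      ring
  rw [e1, e2, e3]
  ring

/-- A weighted Koksma-Hlawka inequality: if `S` vanishes in the corner `(a, c)`, the integration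
error of `S * W` is at most the Hardy-Krause variation of `S` times the largest integration error of
`W` restricted to a quadrant. Rounding the argument of `S` down to a fine grid turns `S * W` into a
combination of such restrictions, whose coefficients are the increments of `S`. -/
lemma abs_empiricalError_mul_le {ν : Measure (ℝ × ℝ)} [IsProbabilityMeasure ν] {a b c d : ℝ}
    (hab : a < b) (hcd : c < d) (hν : ∀ᵐ q ∂ν, q ∈ Icc a b ×ˢ Icc c d) {z : ℕ → ℝ × ℝ}
    (hz : ∀ j, z j ∈ Icc a b ×ˢ Icc c d) {W : ℝ × ℝ → ℝ} (hW : Measurable W) {C : ℝ}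
    (hC : ∀ q, |W q| ≤ C) {S : ℝ × ℝ → ℝ} (hS : ContinuousOn S (Icc a b ×ˢ Icc c d))
    (hS0 : S (a, c) = 0) {V : ℝ≥0} (hV : hkVariation a b c d S ≤ V) {m : ℕ} {ε : ℝ} (hε : 0 ≤ ε)
    (herr : ∀ u ∈ Icc a b, ∀ v ∈ Icc c d,
      |empiricalError ν z m ((Ici u ×ˢ Ici v).indicator W)| ≤ ε) :
    |empiricalError ν z m (fun q => S q * W q)| ≤ V * ε := by
  have hQ : IsCompact (Icc a b ×ˢ Icc c d) := isCompact_Icc.prod isCompact_Icc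
  have hC0 : 0 ≤ C := (abs_nonneg _).trans (hC 0)
  have hWint : Integrable W ν :=
    Integrable.of_bound hW.aestronglyMeasurable C (Eventually.of_forall hC)
  have hSW : Integrable (fun q => S q * W q) ν :=
    (integrable_of_continuousOn hQ hν hS).mul_bdd (c := C) hW.aestronglyMeasurable
      (Eventually.of_forall hC)
  refine le_of_forall_pos_le_add fun κ hκ => ?_
  -- `C + 1` in place of `C`, which may be `0`
  set η := κ / (2 * (C + 1)) with hη
  have hη0 : 0 < η := by positivity
  have huc := hQ.uniformContinuousOn_of_continuous hS
  rw [Metric.uniformContinuousOn_iff] at huc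
  obtain ⟨ρ, hρ, huc⟩ := huc η hη0
  obtain ⟨n, hn0, hn1, hn2⟩ : ∃ n : ℕ, 0 < n ∧ (b - a) / n < ρ ∧ (d - c) / n < ρ := by
    have t1 := tendsto_const_div_atTop_nhds_zero_nat (b - a)
    have t2 := tendsto_const_div_atTop_nhds_zero_nat (d - c)
    obtain ⟨n, h1, h2, h3⟩ := ((eventually_gt_atTop 0).and
      ((t1.eventually_lt_const hρ).and (t2.eventually_lt_const hρ))).exists
    exact ⟨n, h1, h2, h3⟩
  set u := gridPoint a b n with hu
  set v := gridPoint c d n with hv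
  have hu' : ∀ i, u i ∈ Icc a b := gridPoint_mem hab.le n
  have hv' : ∀ i, v i ∈ Icc c d := gridPoint_mem hcd.le n
  set N := Finset.range n
  set χ : ℝ → ℝ → ℝ × ℝ → ℝ := fun s t => (Ici s ×ˢ Ici t).indicator W with hχ
  have hχint : ∀ s t, Integrable (χ s t) ν := fun s t =>
    hWint.indicator (measurableSet_Ici.prod measurableSet_Ici)
  set γ : ℕ × ℕ → ℝ := fun i => S (u (i.1 + 1), v (i.2 + 1)) - S (u (i.1 + 1), v i.2)
    - S (u i.1, v (i.2 + 1)) + S (u i.1, v i.2) with hγ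
  set α : ℕ → ℝ := fun i => S (u (i + 1), c) - S (u i, c) with hα
  set β : ℕ → ℝ := fun j => S (a, v (j + 1)) - S (a, v j) with hβ
  set F₁ : ℝ × ℝ → ℝ := fun q => ∑ i ∈ N ×ˢ N, γ i * χ (u (i.1 + 1)) (v (i.2 + 1)) q with hF₁
  set F₂ : ℝ × ℝ → ℝ := fun q => ∑ i ∈ N, α i * χ (u (i + 1)) c q with hF₂
  set F₃ : ℝ × ℝ → ℝ := fun q => ∑ j ∈ N, β j * χ a (v (j + 1)) q with hF₃
  have i1 : Integrable F₁ ν := integrable_finsetSum _ fun i _ => (hχint _ _).const_mul _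
  have i2 : Integrable F₂ ν := integrable_finsetSum _ fun i _ => (hχint _ _).const_mul _
  have i3 : Integrable F₃ ν := integrable_finsetSum _ fun i _ => (hχint _ _).const_mul _
  have hstep : |empiricalError ν z m (fun q => F₁ q + F₂ q + F₃ q)| ≤ V * ε := by
    rw [empiricalError_add (f₁ := fun q => F₁ q + F₂ q) (i1.add i2) i3, empiricalError_add i1 i2,
      empiricalError_sum _ _ fun i _ => hχint _ _, empiricalError_sum _ _ fun i _ => hχint _ _,
      empiricalError_sum _ _ fun i _ => hχint _ _]
    have bound : ∀ {ι : Type} (s : Finset ι) (k : ι → ℝ) (e : ι → ℝ), (∀ i, |e i| ≤ ε) →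
        |∑ i ∈ s, k i * e i| ≤ (∑ i ∈ s, |k i|) * ε := by
      intro ι s k e he
      rw [Finset.sum_mul]
      refine (Finset.abs_sum_le_sum_abs _ _).trans (Finset.sum_le_sum fun i _ => ?_)
      rw [abs_mul]
      exact mul_le_mul_of_nonneg_left (he i) (abs_nonneg _)
    have hvar := sum_abs_increments_le_of_hkVariation_le hV (monotone_gridPoint hab.le n) hu'
      (monotone_gridPoint hcd.le n) hv' n
    refine (abs_add_three _ _ _).trans ?_
    refine (add_le_add (add_le_add
      (bound _ γ _ fun i => herr _ (hu' _) _ (hv' _))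
      (bound _ α _ fun i => herr _ (hu' _) _ (left_mem_Icc.2 hcd.le)))
      (bound _ β _ fun i => herr _ (left_mem_Icc.2 hab.le) _ (hv' _))).trans ?_
    rw [← add_mul, ← add_mul, Finset.sum_product]
    exact mul_le_mul_of_nonneg_right hvar hε
  have hclose : ∀ q ∈ Icc a b ×ˢ Icc c d, |S q * W q - (F₁ q + F₂ q + F₃ q)| ≤ η * C := by
    rintro ⟨x, y⟩ ⟨hx, hy⟩
    obtain ⟨k, hkn, hk, hki⟩ := exists_gridPoint_le hab hn0 hx
    obtain ⟨l, hln, hl, hlj⟩ := exists_gridPoint_le hcd hn0 hy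
    have hsum : F₁ (x, y) + F₂ (x, y) + F₃ (x, y) = (S (u k, v l) - S (a, c)) * W (x, y) := by
      simp only [hF₁, Finset.sum_product]
      exact sum_increments_mul_quadrant S W (gridPoint_zero a b n) (gridPoint_zero c d n) hx.1 hy.1
        hkn hln hki hlj
    have e : S (x, y) * W (x, y) - (F₁ (x, y) + F₂ (x, y) + F₃ (x, y))
        = (S (x, y) - S (u k, v l)) * W (x, y) := by
      rw [hsum, hS0]
      ring
    rw [e, abs_mul]
    refine mul_le_mul ?_ (hC _) (abs_nonneg _) hη0.le
    rw [← Real.dist_eq]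
    refine (huc _ ⟨hx, hy⟩ _ ⟨hu' k, hv' l⟩ ?_).le
    rw [dist_comm, Prod.dist_eq, Real.dist_eq, Real.dist_eq]
    exact max_lt (hk.trans_lt hn1) (hl.trans_lt hn2)
  have hfin := abs_empiricalError_sub_le hSW ((i1.add i2).add i3) hν hz (by positivity) hclose m
  have hκ' : 2 * (η * C) ≤ κ := by
    calc 2 * (η * C) ≤ 2 * (η * (C + 1)) := by gcongr; linarith
      _ = κ := by rw [hη]; field_simp
  have := abs_sub_abs_le_abs_sub (empiricalError ν z m fun q => S q * W q)
    (empiricalError ν z m fun q => F₁ q + F₂ q + F₃ q)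
  have hfin' : |(empiricalError ν z m fun q => S q * W q)
    - empiricalError ν z m fun q => F₁ q + F₂ q + F₃ q| ≤ 2 * (η * C) := hfin
  linarith

end KoksmaHlawka

/-! ### Normal equations, empirical and in `L²` -/

section NormalEquations

variable {κ E : Type*}

/-- The quadratic function `v ↦ v ⬝ G v - 2 b ⬝ v` with a positive definite `G` has the solution
of the normal equations `G w = b` as its unique minimizer. -/
lemma quadratic_lt_of_posDef [Fintype κ] {G : Matrix κ κ ℝ} (hG : G.PosDef) {b w v : κ → ℝ}
    (hw : G *ᵥ w = b) (hvw : v ≠ w) :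
    w ⬝ᵥ G *ᵥ w - 2 * (b ⬝ᵥ w) < v ⬝ᵥ G *ᵥ v - 2 * (b ⬝ᵥ v) := by
  have hpos := hG.dotProduct_mulVec_pos (sub_ne_zero.2 hvw)
  have hsymm : w ⬝ᵥ G *ᵥ v = (G *ᵥ w) ⬝ᵥ v := by
    rw [Matrix.dotProduct_mulVec, ← Matrix.mulVec_transpose]
    congr 2
    simpa using hG.isHermitian.eq
  simp only [star_trivial, Matrix.mulVec_sub, sub_dotProduct, dotProduct_sub, hsymm] at hpos
  rw [hw] at hpos ⊢
  rw [dotProduct_comm v b, dotProduct_comm w b] at hpos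
  rw [dotProduct_comm w b]
  linarith

/-- The Gram matrix of the functions `W k` in the mean over the first `m` points. -/
noncomputable def empiricalGram (W : κ → E → ℝ) (z : ℕ → E) (m : ℕ) : Matrix κ κ ℝ :=
  Matrix.of fun k l => (∑ j ∈ Finset.range m, W k (z j) * W l (z j)) / m

/-- The moments of the data `y` with the functions `W k` in the mean over the first `m` points. -/
noncomputable def empiricalMoment (W : κ → E → ℝ) (z : ℕ → E) (m : ℕ) (y : ℕ → ℝ) : κ → ℝ :=
  fun k => (∑ j ∈ Finset.range m, y j * W k (z j)) / m

lemma empiricalMoment_add (W : κ → E → ℝ) (z : ℕ → E) (m : ℕ) (y y' : ℕ → ℝ) :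
    empiricalMoment W z m (fun j => y j + y' j)
      = empiricalMoment W z m y + empiricalMoment W z m y' := by
  ext k
  simp only [empiricalMoment, Pi.add_apply, add_mul, Finset.sum_add_distrib, add_div]

lemma inv_mulVec_eq [Fintype κ] [DecidableEq κ] {G : Matrix κ κ ℝ} (hG : G.det ≠ 0) {w b : κ → ℝ}
    (h : G *ᵥ w = b) : G⁻¹ *ᵥ b = w := by
  rw [← h, Matrix.mulVec_mulVec, Matrix.nonsing_inv_mul _ (Ne.isUnit hG), Matrix.one_mulVec]

lemma mulVec_inv_mulVec [Fintype κ] [DecidableEq κ] {G : Matrix κ κ ℝ} (hG : G.det ≠ 0)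
    (b : κ → ℝ) : G *ᵥ (G⁻¹ *ᵥ b) = b := by
  rw [Matrix.mulVec_mulVec, Matrix.mul_nonsing_inv _ (Ne.isUnit hG), Matrix.one_mulVec]

/-- Adding a constant to the data adds it to all coefficients, for a partition of unity. -/
lemma inv_empiricalGram_mulVec_add_const [Fintype κ] [DecidableEq κ] {W : κ → E → ℝ} {z : ℕ → E}
    (hone : ∀ j, ∑ k, W k (z j) = 1) {m : ℕ} (hdet : (empiricalGram W z m).det ≠ 0)
    (y : ℕ → ℝ) (s : ℝ) :
    (empiricalGram W z m)⁻¹ *ᵥ empiricalMoment W z m (fun j => y j + s)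
      = (empiricalGram W z m)⁻¹ *ᵥ empiricalMoment W z m y + fun _ => s := by
  refine inv_mulVec_eq hdet ?_
  rw [Matrix.mulVec_add, mulVec_inv_mulVec hdet, empiricalMoment_add]
  congr 1
  ext k
  simp only [Matrix.mulVec, dotProduct, empiricalGram, empiricalMoment, Matrix.of_apply]
  simp_rw [div_mul_eq_mul_div]
  rw [← Finset.sum_div]
  congr 1
  simp_rw [Finset.sum_mul]
  rw [Finset.sum_comm]
  refine Finset.sum_congr rfl fun j _ => ?_
  rw [← Finset.sum_mul, ← Finset.mul_sum, hone, mul_one, mul_comm]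

variable [MeasurableSpace E]

/-- The Gram matrix of the functions `W k` in `L²(ν)`. -/
noncomputable def gram (ν : Measure E) (W : κ → E → ℝ) : Matrix κ κ ℝ :=
  Matrix.of fun k l => ∫ q, W k q * W l q ∂ν

/-- The moments of `S` with the functions `W k` in `L²(ν)`. -/
noncomputable def momentVector (ν : Measure E) (W : κ → E → ℝ) (S : E → ℝ) : κ → ℝ :=
  fun k => ∫ q, S q * W k q ∂ν

variable {ν : Measure E} {W : κ → E → ℝ} {C : ℝ}

lemma integrable_mul_of_bound (hW : ∀ k, Measurable (W k)) (hC : ∀ k q, |W k q| ≤ C)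
    {S : E → ℝ} (hS : Integrable S ν) (k : κ) : Integrable (fun q => S q * W k q) ν :=
  hS.mul_bdd (c := C) (hW k).aestronglyMeasurable (Eventually.of_forall (hC k))

lemma integrable_of_bound [IsProbabilityMeasure ν] (hW : ∀ k, Measurable (W k))
    (hC : ∀ k q, |W k q| ≤ C) (k : κ) : Integrable (W k) ν :=
  Integrable.of_bound (hW k).aestronglyMeasurable C (Eventually.of_forall (hC k))

lemma dotProduct_gram_mulVec [Fintype κ] [IsProbabilityMeasure ν]
    (hW : ∀ k, Measurable (W k)) (hC : ∀ k q, |W k q| ≤ C)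
    (v : κ → ℝ) : v ⬝ᵥ gram ν W *ᵥ v = ∫ q, (∑ k, v k * W k q) ^ 2 ∂ν := by
  have hint : ∀ k l, Integrable (fun q => v k * (v l * (W k q * W l q))) ν := fun k l =>
    ((integrable_mul_of_bound hW hC (integrable_of_bound hW hC k) l).const_mul _).const_mul _
  have e : ∀ q, (∑ k, v k * W k q) ^ 2 = ∑ k, ∑ l, v k * (v l * (W k q * W l q)) := fun q => by
    rw [sq, Finset.sum_mul_sum]
    refine Finset.sum_congr rfl fun k _ => Finset.sum_congr rfl fun l _ => ?_
    ring
  simp_rw [e]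
  rw [integral_finsetSum _ fun k _ => integrable_finsetSum _ fun l _ => hint k l]
  simp only [dotProduct, Matrix.mulVec]
  refine Finset.sum_congr rfl fun k _ => ?_
  rw [integral_finsetSum _ fun l _ => hint k l, Finset.mul_sum]
  refine Finset.sum_congr rfl fun l _ => ?_
  rw [integral_const_mul, integral_const_mul, gram, Matrix.of_apply]
  ring

lemma integrable_sum_mul [Fintype κ] [IsProbabilityMeasure ν]
    (hW : ∀ k, Measurable (W k)) (hC : ∀ k q, |W k q| ≤ C)
    (v : κ → ℝ) : Integrable (fun q => ∑ k, v k * W k q) ν :=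
  integrable_finsetSum _ fun k _ => (integrable_of_bound hW hC k).const_mul _

lemma integrable_mul_sum [Fintype κ] (hW : ∀ k, Measurable (W k)) (hC : ∀ k q, |W k q| ≤ C)
    {S : E → ℝ} (hS : Integrable S ν) (v : κ → ℝ) :
    Integrable (fun q => S q * ∑ k, v k * W k q) ν := by
  simp_rw [Finset.mul_sum]
  refine integrable_finsetSum _ fun k _ => ?_
  refine ((integrable_mul_of_bound hW hC hS k).const_mul (v k)).congr (Eventually.of_forall ?_)
  intro q
  dsimp only
  ring

/-- Functions that are linearly independent modulo null functions have a positive definite Gram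
matrix. -/
lemma posDef_gram [Fintype κ] [IsProbabilityMeasure ν]
    (hW : ∀ k, Measurable (W k)) (hC : ∀ k q, |W k q| ≤ C)
    (hindep : ∀ v : κ → ℝ, (∀ᵐ q ∂ν, ∑ k, v k * W k q = 0) → v = 0) : (gram ν W).PosDef := by
  refine Matrix.PosDef.of_dotProduct_mulVec_pos ?_ fun v hv => ?_
  · ext k l
    simp [gram, mul_comm]
  · rw [star_trivial, dotProduct_gram_mulVec hW hC]
    refine lt_of_le_of_ne (integral_nonneg fun q => sq_nonneg _) fun h0 => hv (hindep v ?_)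
    have hint : Integrable (fun q => (∑ k, v k * W k q) ^ 2) ν := by
      simp_rw [sq]
      exact integrable_mul_sum hW hC (integrable_sum_mul hW hC v) v
    have := (integral_eq_zero_iff_of_nonneg (fun q => sq_nonneg _) hint).1 h0.symm
    filter_upwards [this] with q hq
    exact pow_eq_zero_iff two_ne_zero |>.1 hq

lemma integral_sub_sum_sq [Fintype κ] [IsProbabilityMeasure ν]
    (hW : ∀ k, Measurable (W k)) (hC : ∀ k q, |W k q| ≤ C)
    {S : E → ℝ} (hS : Integrable S ν) (hS2 : Integrable (fun q => S q ^ 2) ν) (v : κ → ℝ) :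
    ∫ q, (S q - ∑ k, v k * W k q) ^ 2 ∂ν
      = ∫ q, S q ^ 2 ∂ν + (v ⬝ᵥ gram ν W *ᵥ v - 2 * (momentVector ν W S ⬝ᵥ v)) := by
  have hm : momentVector ν W S ⬝ᵥ v = ∫ q, S q * ∑ k, v k * W k q ∂ν := by
    simp_rw [Finset.mul_sum]
    rw [integral_finsetSum]
    · simp only [dotProduct, momentVector]
      refine Finset.sum_congr rfl fun k _ => ?_
      rw [← integral_mul_const]
      congr 1
      ext q
      ring
    · intro k _
      refine ((integrable_mul_of_bound hW hC hS k).const_mul (v k)).congr (Eventually.of_forall ?_)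
      intro q
      dsimp only
      ring
  have h1 := integrable_mul_sum hW hC hS v
  have h2 : Integrable (fun q => (∑ k, v k * W k q) ^ 2) ν := by
    simp_rw [sq]
    exact integrable_mul_sum hW hC (integrable_sum_mul hW hC v) v
  rw [dotProduct_gram_mulVec hW hC, hm, ← integral_const_mul, ← integral_sub h2 (h1.const_mul 2),
    ← integral_add hS2 (g := fun q => (∑ k, v k * W k q) ^ 2 - 2 * (S q * ∑ k, v k * W k q))
      (h2.sub (h1.const_mul 2))]
  congr 1
  ext q
  ring

lemma tendsto_inv_empiricalGram [Fintype κ] [DecidableEq κ] {z : ℕ → E}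
    (hG : ∀ k l, Tendsto (fun m => empiricalGram W z m k l) atTop (𝓝 (gram ν W k l)))
    (hdet : (gram ν W).det ≠ 0) :
    (∀ᶠ m in atTop, (empiricalGram W z m).det ≠ 0) ∧
      ∀ k l, Tendsto (fun m => (empiricalGram W z m)⁻¹ k l) atTop (𝓝 ((gram ν W)⁻¹ k l)) := by
  have h : Tendsto (fun m => empiricalGram W z m) atTop (𝓝 (gram ν W)) :=
    tendsto_pi_nhds.2 fun k => tendsto_pi_nhds.2 fun l => hG k l
  have hd : Tendsto (fun m => (empiricalGram W z m).det) atTop (𝓝 (gram ν W).det) :=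
    ((continuous_id.matrix_det).tendsto _).comp h
  have ha : Tendsto (fun m => (empiricalGram W z m).adjugate) atTop (𝓝 (gram ν W).adjugate) :=
    ((continuous_id.matrix_adjugate).tendsto _).comp h
  refine ⟨hd.eventually_ne hdet, fun k l => ?_⟩
  simp only [Matrix.inv_def, Ring.inverse_eq_inv', Matrix.smul_apply, smul_eq_mul]
  exact (hd.inv₀ hdet).mul (tendsto_pi_nhds.1 (tendsto_pi_nhds.1 ha k) l)

lemma inv_gram_mulVec_add_const [Fintype κ] [DecidableEq κ] [IsProbabilityMeasure ν]
    (hW : ∀ k, Measurable (W k)) (hC : ∀ k q, |W k q| ≤ C)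
    (hone : ∀ᵐ q ∂ν, ∑ k, W k q = 1) (hdet : (gram ν W).det ≠ 0) {S : E → ℝ}
    (hS : Integrable S ν) (s : ℝ) :
    (gram ν W)⁻¹ *ᵥ momentVector ν W (fun q => S q + s)
      = (gram ν W)⁻¹ *ᵥ momentVector ν W S + fun _ => s := by
  refine inv_mulVec_eq hdet ?_
  rw [Matrix.mulVec_add, mulVec_inv_mulVec hdet]
  ext k
  simp only [Pi.add_apply, Matrix.mulVec, dotProduct, gram, momentVector, Matrix.of_apply, add_mul]
  rw [integral_add (integrable_mul_of_bound hW hC hS k)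
    (integrable_mul_of_bound hW hC (integrable_const s) k), ← Finset.sum_mul,
    ← integral_finsetSum _ fun l _ =>
      integrable_mul_of_bound hW hC (integrable_of_bound hW hC k) l, ← integral_mul_const]
  congr 1
  refine integral_congr_ae ?_
  filter_upwards [hone] with q hq
  rw [← Finset.mul_sum, hq]
  ring

end NormalEquations

/-! ### Uniform convergence over a class of bounded variation -/

section Uniform

lemma hkVariation_sub_const (a b c d : ℝ) (S : ℝ × ℝ → ℝ) (s : ℝ) :
    hkVariation a b c d (fun q => S q - s) = hkVariation a b c d S := by
  have e : ∀ x y z w : ℝ, x - s - (y - s) - (z - s) + (w - s) = x - y - z + w := by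
    intro x y z w
    ring
  simp only [hkVariation, vitaliVariation, eVariationOn, edist_sub_right, e]

/-- A function of bounded Hardy-Krause variation that vanishes in the corner is bounded. -/
lemma abs_le_of_hkVariation_le {a b c d : ℝ} {S : ℝ × ℝ → ℝ} (hS0 : S (a, c) = 0) {V : ℝ≥0}
    (hV : hkVariation a b c d S ≤ V) {q : ℝ × ℝ} (hq : q ∈ Icc a b ×ˢ Icc c d) : |S q| ≤ V := by
  obtain ⟨x, y⟩ := q
  obtain ⟨hx, hy⟩ := hq
  have hab : a ≤ b := hx.1.trans hx.2
  have hcd : c ≤ d := hy.1.trans hy.2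
  have mono : ∀ {s t : ℝ}, s ≤ t → Monotone fun i : ℕ => if i = 0 then s else t := by
    intro s t hst i j hij
    dsimp only
    split_ifs <;> first | exact le_rfl | exact hst | omega
  have h := sum_abs_increments_le_of_hkVariation_le hV (mono hx.1)
    (fun i => by split_ifs; exacts [left_mem_Icc.2 hab, hx]) (mono hy.1)
    (fun i => by split_ifs; exacts [left_mem_Icc.2 hcd, hy]) 1
  simp only [Finset.sum_range_one, if_true, zero_add, one_ne_zero, if_false, hS0] at h
  refine le_trans (le_of_eq_of_le ?_ (abs_add_three _ _ _)) h
  congr 1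
  ring

variable {κ : Type*} [Fintype κ] [DecidableEq κ]

/-- Uniform convergence of the least-squares coefficients over a class of bounded variation, for a
fixed sequence of design points `z` and errors `e` that obey the laws of large numbers. As the
variation does not see constants, the class is unbounded; the constants are split off first. -/
lemma tendsto_leastSquares_sub {ν : Measure (ℝ × ℝ)} [IsProbabilityMeasure ν] {a b c d : ℝ}
    (hab : a < b) (hcd : c < d) (hν : ∀ᵐ q ∂ν, q ∈ Icc a b ×ˢ Icc c d) {z : ℕ → ℝ × ℝ}
    (hz : ∀ j, z j ∈ Icc a b ×ˢ Icc c d) {W : κ → ℝ × ℝ → ℝ} (hW : ∀ k, Measurable (W k)) {C : ℝ}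
    (hC : ∀ k q, |W k q| ≤ C) (hone : ∀ q ∈ Icc a b ×ˢ Icc c d, ∑ k, W k q = 1)
    (hdet : (gram ν W).det ≠ 0) {e : ℕ → ℝ}
    (hG : ∀ k l, Tendsto (fun m => empiricalGram W z m k l) atTop (𝓝 (gram ν W k l)))
    (he : ∀ k, Tendsto (fun m => empiricalMoment W z m e k) atTop (𝓝 0))
    (herr : ∀ k, ∀ ε > 0, ∀ᶠ m in atTop, ∀ u ∈ Icc a b, ∀ v ∈ Icc c d,
      |empiricalError ν z m ((Ici u ×ˢ Ici v).indicator (W k))| ≤ ε) (V : ℝ≥0) (k : κ) :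
    Tendsto (fun x : ℕ × (ℝ × ℝ → ℝ) =>
        ((empiricalGram W z x.1)⁻¹ *ᵥ empiricalMoment W z x.1 (fun j => x.2 (z j) + e j)) k
          - ((gram ν W)⁻¹ *ᵥ momentVector ν W x.2) k)
      (atTop ×ˢ 𝓟 {S | ContinuousOn S (Icc a b ×ˢ Icc c d) ∧ hkVariation a b c d S ≤ V})
      (𝓝 0) := by
  set 𝓢 := {S | ContinuousOn S (Icc a b ×ˢ Icc c d) ∧ hkVariation a b c d S ≤ V}
  have hQ : IsCompact (Icc a b ×ˢ Icc c d) := isCompact_Icc.prod isCompact_Icc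
  -- the surfaces normalized to vanish in the corner
  set S₀ : (ℝ × ℝ → ℝ) → ℝ × ℝ → ℝ := fun S q => S q - S (a, c) with hS₀
  have hcont : ∀ S ∈ 𝓢, ContinuousOn (S₀ S) (Icc a b ×ˢ Icc c d) := fun S hS =>
    hS.1.sub continuousOn_const
  have hint : ∀ S ∈ 𝓢, Integrable (S₀ S) ν := fun S hS =>
    integrable_of_continuousOn hQ hν (hcont S hS)
  have hvar : ∀ S ∈ 𝓢, hkVariation a b c d (S₀ S) ≤ V := fun S hS =>
    (hkVariation_sub_const a b c d S _).le.trans hS.2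
  have hzero : ∀ S, S₀ S (a, c) = 0 := fun S => sub_self _
  have hmem : ∀ᶠ x : ℕ × (ℝ × ℝ → ℝ) in atTop ×ˢ 𝓟 𝓢, x.2 ∈ 𝓢 := by
    rw [eventually_prod_principal_iff]
    exact Eventually.of_forall fun _ S hS => hS
  have hmb : ∀ l, ∀ᶠ x : ℕ × (ℝ × ℝ → ℝ) in atTop ×ˢ 𝓟 𝓢,
      |momentVector ν W (S₀ x.2) l| ≤ V * C := by
    intro l
    filter_upwards [hmem] with x hx
    have := norm_integral_le_of_norm_le_const (μ := ν) (f := fun q => S₀ x.2 q * W l q)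
      (C := V * C) (by
        filter_upwards [hν] with q hq
        rw [norm_mul]
        exact mul_le_mul (abs_le_of_hkVariation_le (hzero _) (hvar _ hx) hq) (hC l q)
          (abs_nonneg _) V.2)
    simpa [momentVector] using this
  have hmd : ∀ l, Tendsto (fun x : ℕ × (ℝ × ℝ → ℝ) =>
      empiricalMoment W z x.1 (fun j => S₀ x.2 (z j) + e j) l - momentVector ν W (S₀ x.2) l)
      (atTop ×ˢ 𝓟 𝓢) (𝓝 0) := by
    intro l
    have h1 : Tendsto (fun x : ℕ × (ℝ × ℝ → ℝ) =>
        empiricalError ν z x.1 (fun q => S₀ x.2 q * W l q)) (atTop ×ˢ 𝓟 𝓢) (𝓝 0) := by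
      rw [Metric.tendsto_nhds]
      intro ε hε
      rw [eventually_prod_principal_iff]
      filter_upwards [herr l (ε / (V + 1)) (by positivity)] with m hm S hS
      rw [Real.dist_eq, sub_zero]
      refine (abs_empiricalError_mul_le hab hcd hν hz (hW l) (hC l) (hcont S hS) (hzero S)
        (hvar S hS) (by positivity) hm).trans_lt ?_
      rw [mul_div_assoc', div_lt_iff₀ (by positivity)]
      nlinarith
    have h2 := h1.add ((he l).comp tendsto_fst)
    rw [add_zero] at h2
    refine h2.congr fun x => ?_
    rw [empiricalMoment_add]
    simp only [Pi.add_apply, empiricalMoment, empiricalError, momentVector, Function.comp_apply]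
    ring
  obtain ⟨hdet', hinv⟩ := tendsto_inv_empiricalGram hG hdet
  have hlim : Tendsto (fun x : ℕ × (ℝ × ℝ → ℝ) => ∑ l,
      (((empiricalGram W z x.1)⁻¹ k l - (gram ν W)⁻¹ k l) * momentVector ν W (S₀ x.2) l
        + (empiricalGram W z x.1)⁻¹ k l *
          (empiricalMoment W z x.1 (fun j => S₀ x.2 (z j) + e j) l - momentVector ν W (S₀ x.2) l)))
      (atTop ×ˢ 𝓟 𝓢) (𝓝 0) := by
    rw [← Finset.sum_const_zero (s := (Finset.univ : Finset κ))]
    refine tendsto_finsetSum _ fun l _ => ?_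
    have t1 : Tendsto (fun x : ℕ × (ℝ × ℝ → ℝ) => (empiricalGram W z x.1)⁻¹ k l)
      (atTop ×ˢ 𝓟 𝓢) (𝓝 ((gram ν W)⁻¹ k l)) := (hinv k l).comp tendsto_fst
    have t2 := bdd_le_mul_tendsto_zero' (V * C) (hmb l)
      (by simpa using t1.sub_const ((gram ν W)⁻¹ k l))
    have t3 := t1.mul (hmd l)
    rw [mul_zero] at t3
    simpa [mul_comm] using t2.add t3
  refine hlim.congr' ?_
  have hdet'' : ∀ᶠ x : ℕ × (ℝ × ℝ → ℝ) in atTop ×ˢ 𝓟 𝓢, (empiricalGram W z x.1).det ≠ 0 :=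
    tendsto_fst.eventually hdet'
  filter_upwards [hdet'', hmem] with x hx hxS
  have e1 : (fun j => x.2 (z j) + e j) = fun j => (S₀ x.2 (z j) + e j) + x.2 (a, c) := by
    ext j
    simp only [hS₀]
    ring
  have e2 : momentVector ν W x.2 = momentVector ν W fun q => S₀ x.2 q + x.2 (a, c) := by
    simp only [hS₀, sub_add_cancel]
  rw [e1, e2, inv_empiricalGram_mulVec_add_const (fun j => hone _ (hz j)) hx,
    inv_gram_mulVec_add_const hW hC (hν.mono hone) hdet (hint _ hxS), Pi.add_apply, Pi.add_apply,
    add_sub_add_right_eq_sub]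
  simp only [Matrix.mulVec, dotProduct]
  rw [← Finset.sum_sub_distrib]
  refine Finset.sum_congr rfl fun l _ => ?_
  ring

end Uniform

/-! ### The tensor product basis and its least-squares problems -/

section TensorProduct

variable {R L : ℕ}

/-- The tensor product basis, cut off outside the rectangle to make it bounded. The index has the
coordinate of the second factor first, as the columns of `designMatrix` do. -/
noncomputable def tensorBasis (a b c d : ℝ) (Bx : Fin R → ℝ → ℝ) (By : Fin L → ℝ → ℝ)
    (k : Fin L × Fin R) : ℝ × ℝ → ℝ :=
  (Icc a b ×ˢ Icc c d).indicator fun q => By k.1 q.2 * Bx k.2 q.1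

variable {a b c d : ℝ} {Bx : Fin R → ℝ → ℝ} {By : Fin L → ℝ → ℝ}

lemma tensorBasis_apply {q : ℝ × ℝ} (hq : q ∈ Icc a b ×ˢ Icc c d) (k : Fin L × Fin R) :
    tensorBasis a b c d Bx By k q = By k.1 q.2 * Bx k.2 q.1 := indicator_of_mem hq _

lemma measurable_tensorBasis (hBx : ∀ r, Measurable (Bx r)) (hBy : ∀ l, Measurable (By l))
    (k : Fin L × Fin R) : Measurable (tensorBasis a b c d Bx By k) :=
  (((hBy k.1).comp measurable_snd).mul ((hBx k.2).comp measurable_fst)).indicator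
    (measurableSet_Icc.prod measurableSet_Icc)

lemma exists_abs_tensorBasis_le (hBx : ∀ r, ∃ C, ∀ x ∈ Icc a b, |Bx r x| ≤ C)
    (hBy : ∀ l, ∃ C, ∀ y ∈ Icc c d, |By l y| ≤ C) :
    ∃ C, ∀ k q, |tensorBasis a b c d Bx By k q| ≤ C := by
  choose Cx hCx using hBx
  choose Cy hCy using hBy
  refine ⟨∑ k : Fin L × Fin R, |Cy k.1| * |Cx k.2|, fun k q => ?_⟩
  refine le_trans ?_ (Finset.single_le_sum (f := fun k : Fin L × Fin R => |Cy k.1| * |Cx k.2|)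
    (fun k _ => by positivity) (Finset.mem_univ k))
  by_cases hq : q ∈ Icc a b ×ˢ Icc c d
  · rw [tensorBasis_apply hq, abs_mul]
    exact mul_le_mul ((hCy _ _ hq.2).trans (le_abs_self _)) ((hCx _ _ hq.1).trans (le_abs_self _))
      (abs_nonneg _) (abs_nonneg _)
  · rw [tensorBasis, indicator_of_notMem hq, abs_zero]
    positivity

lemma tensorSpline_eq_sum {q : ℝ × ℝ} (hq : q ∈ Icc a b ×ˢ Icc c d)
    (Θ : Matrix (Fin R) (Fin L) ℝ) :
    tensorSpline Bx By Θ q = ∑ k, Θ.vec k * tensorBasis a b c d Bx By k q := by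
  rw [tensorSpline, Fintype.sum_prod_type, Finset.sum_comm]
  refine Finset.sum_congr rfl fun l _ => Finset.sum_congr rfl fun r _ => ?_
  rw [tensorBasis_apply hq, Matrix.vec]
  ring

lemma sum_tensorBasis (hBx : ∀ x ∈ Icc a b, ∑ r, Bx r x = 1) (hBy : ∀ y ∈ Icc c d, ∑ l, By l y = 1)
    {q : ℝ × ℝ} (hq : q ∈ Icc a b ×ˢ Icc c d) : ∑ k, tensorBasis a b c d Bx By k q = 1 := by
  simp_rw [tensorBasis_apply hq]
  rw [Fintype.sum_prod_type]
  simp_rw [← Finset.mul_sum, hBx _ hq.1, mul_one, hBy _ hq.2]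

/-- If the factors are linearly independent modulo null functions, then so is their tensor
product. -/
lemma tensorBasis_linearIndependent {h g : Measure ℝ} [IsProbabilityMeasure h]
    [IsProbabilityMeasure g] (hh : h (Icc a b)ᶜ = 0) (hg : g (Icc c d)ᶜ = 0)
    (hBx : ∀ v : Fin R → ℝ, (∀ᵐ x ∂h, ∑ r, v r * Bx r x = 0) → ∀ r, v r = 0)
    (hBy : ∀ v : Fin L → ℝ, (∀ᵐ y ∂g, ∑ l, v l * By l y = 0) → ∀ l, v l = 0)
    (v : Fin L × Fin R → ℝ)
    (hv : ∀ᵐ q ∂(h.prod g), ∑ k, v k * tensorBasis a b c d Bx By k q = 0) : v = 0 := by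
  have hv' : ∀ᵐ q ∂(h.prod g), ∑ l, (∑ r, v (l, r) * Bx r q.1) * By l q.2 = 0 := by
    filter_upwards [hv, ae_mem_rect hh hg] with q hq hqQ
    rw [← hq, Fintype.sum_prod_type]
    refine Finset.sum_congr rfl fun l _ => ?_
    rw [Finset.sum_mul]
    refine Finset.sum_congr rfl fun r _ => ?_
    rw [tensorBasis_apply hqQ]
    ring
  have hx : ∀ᵐ x ∂h, ∀ l, ∑ r, v (l, r) * Bx r x = 0 := by
    filter_upwards [Measure.ae_ae_of_ae_prod hv'] with x hx
    exact hBy _ hx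
  ext ⟨l, r⟩
  exact hBx (fun r => v (l, r)) (hx.mono fun x hx => hx l) r

lemma transpose_mul_designMatrix {z : ℕ → ℝ × ℝ} (hz : ∀ j, z j ∈ Icc a b ×ˢ Icc c d) {m : ℕ}
    (hm : 0 < m) :
    (designMatrix Bx By (fun j : Fin m => (z j).1) fun j : Fin m => (z j).2)ᵀ
        * designMatrix Bx By (fun j : Fin m => (z j).1) (fun j : Fin m => (z j).2)
      = (m : ℝ) • empiricalGram (tensorBasis a b c d Bx By) z m := by
  ext k l
  have hm' : (m : ℝ) ≠ 0 := by positivity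
  rw [Matrix.smul_apply, empiricalGram, Matrix.of_apply, smul_eq_mul, mul_div_cancel₀ _ hm',
    Finset.sum_range, Matrix.mul_apply]
  refine Finset.sum_congr rfl fun j _ => ?_
  rw [tensorBasis_apply (hz j), tensorBasis_apply (hz j)]
  rfl

lemma transpose_designMatrix_mulVec {z : ℕ → ℝ × ℝ} (hz : ∀ j, z j ∈ Icc a b ×ˢ Icc c d) {m : ℕ}
    (hm : 0 < m) (y : ℕ → ℝ) :
    (designMatrix Bx By (fun j : Fin m => (z j).1) fun j : Fin m => (z j).2)ᵀ
        *ᵥ (fun j : Fin m => y j)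
      = (m : ℝ) • empiricalMoment (tensorBasis a b c d Bx By) z m y := by
  ext k
  have hm' : (m : ℝ) ≠ 0 := by positivity
  rw [Pi.smul_apply, empiricalMoment, smul_eq_mul, mul_div_cancel₀ _ hm', Finset.sum_range,
    Matrix.mulVec, dotProduct]
  refine Finset.sum_congr rfl fun j _ => ?_
  rw [tensorBasis_apply (hz j), mul_comm]
  rfl

lemma det_transpose_mul_designMatrix_ne_zero {z : ℕ → ℝ × ℝ}
    (hz : ∀ j, z j ∈ Icc a b ×ˢ Icc c d) {m : ℕ} (hm : 0 < m)
    (hdet : (empiricalGram (tensorBasis a b c d Bx By) z m).det ≠ 0) :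
    ((designMatrix Bx By (fun j : Fin m => (z j).1) fun j : Fin m => (z j).2)ᵀ
        * designMatrix Bx By (fun j : Fin m => (z j).1) (fun j : Fin m => (z j).2)).det ≠ 0 := by
  have hm' : (m : ℝ) ≠ 0 := by positivity
  rw [transpose_mul_designMatrix hz hm, Matrix.det_smul]
  exact mul_ne_zero (pow_ne_zero _ hm') hdet

lemma lsCoeff_apply {z : ℕ → ℝ × ℝ} (hz : ∀ j, z j ∈ Icc a b ×ˢ Icc c d) {m : ℕ} (hm : 0 < m)
    (hdet : (empiricalGram (tensorBasis a b c d Bx By) z m).det ≠ 0) (y : ℕ → ℝ) (r : Fin R)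
    (l : Fin L) :
    lsCoeff Bx By (fun j : Fin m => (z j).1) (fun j : Fin m => (z j).2) (fun j : Fin m => y j) r l
      = ((empiricalGram (tensorBasis a b c d Bx By) z m)⁻¹
          *ᵥ empiricalMoment (tensorBasis a b c d Bx By) z m y) (l, r) := by
  have hd := det_transpose_mul_designMatrix_ne_zero hz hm hdet
  rw [lsCoeff, Matrix.of_apply, transpose_designMatrix_mulVec hz hm]
  refine congrFun (inv_mulVec_eq hd ?_) (l, r)
  rw [transpose_mul_designMatrix hz hm, Matrix.smul_mulVec, mulVec_inv_mulVec hdet]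

/-- An invertible matrix of the normal equations makes the least-squares solution unique. -/
lemma residualSS_lsCoeff_lt {m : ℕ} {x y : Fin m → ℝ}
    (hdet : ((designMatrix Bx By x y)ᵀ * designMatrix Bx By x y).det ≠ 0) (z : Fin m → ℝ)
    {Θ : Matrix (Fin R) (Fin L) ℝ} (hΘ : Θ ≠ lsCoeff Bx By x y z) :
    residualSS Bx By x y z (lsCoeff Bx By x y z) < residualSS Bx By x y z Θ := by
  set M := designMatrix Bx By x y with hM
  have hpos : (Mᵀ * M).PosDef := by
    have := Matrix.posSemidef_conjTranspose_mul_self M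
    rw [Matrix.conjTranspose_eq_transpose_of_trivial] at this
    exact this.posDef_iff_det_ne_zero.2 hdet
  have hres : ∀ Θ, residualSS Bx By x y z Θ
      = z ⬝ᵥ z + (Θ.vec ⬝ᵥ (Mᵀ * M) *ᵥ Θ.vec - 2 * ((Mᵀ *ᵥ z) ⬝ᵥ Θ.vec)) := by
    intro Θ
    have e : residualSS Bx By x y z Θ = (z - M *ᵥ Θ.vec) ⬝ᵥ (z - M *ᵥ Θ.vec) := by
      rw [residualSS, dotProduct]
      refine Finset.sum_congr rfl fun j _ => ?_
      have : tensorSpline Bx By Θ (x j, y j) = (M *ᵥ Θ.vec) j := by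
        rw [tensorSpline, Matrix.mulVec, dotProduct, Fintype.sum_prod_type, Finset.sum_comm]
        refine Finset.sum_congr rfl fun l _ => Finset.sum_congr rfl fun r _ => ?_
        rw [hM, designMatrix, Matrix.of_apply, Matrix.vec]
        ring
      rw [this, Pi.sub_apply, sq]
    have e1 : Θ.vec ⬝ᵥ (Mᵀ * M) *ᵥ Θ.vec = (M *ᵥ Θ.vec) ⬝ᵥ (M *ᵥ Θ.vec) := by
      rw [← Matrix.mulVec_mulVec, Matrix.dotProduct_mulVec, Matrix.vecMul_transpose]
    have e2 : (Mᵀ *ᵥ z) ⬝ᵥ Θ.vec = z ⬝ᵥ (M *ᵥ Θ.vec) := by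
      rw [Matrix.mulVec_transpose, ← Matrix.dotProduct_mulVec]
    rw [e, e1, e2]
    simp only [sub_dotProduct, dotProduct_sub]
    rw [dotProduct_comm (M *ᵥ Θ.vec) z]
    ring
  rw [hres, hres, add_lt_add_iff_left]
  have hvec : (lsCoeff Bx By x y z).vec = (Mᵀ * M)⁻¹ *ᵥ (Mᵀ *ᵥ z) := rfl
  refine quadratic_lt_of_posDef hpos ?_ fun h => hΘ (Matrix.vec_inj.1 h)
  rw [hvec, mulVec_inv_mulVec hdet]

/-- The coefficient matrix of the best approximation of `S` in `L²(ν)`. -/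
noncomputable def bestCoeff (ν : Measure (ℝ × ℝ)) (a b c d : ℝ) (Bx : Fin R → ℝ → ℝ)
    (By : Fin L → ℝ → ℝ) (S : ℝ × ℝ → ℝ) : Matrix (Fin R) (Fin L) ℝ :=
  Matrix.of fun r l => ((gram ν (tensorBasis a b c d Bx By))⁻¹
    *ᵥ momentVector ν (tensorBasis a b c d Bx By) S) (l, r)

lemma sqDist_bestCoeff_lt {ν : Measure (ℝ × ℝ)} [IsProbabilityMeasure ν]
    (hν : ∀ᵐ q ∂ν, q ∈ Icc a b ×ˢ Icc c d) (hBx : ∀ r, Measurable (Bx r))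
    (hBy : ∀ l, Measurable (By l)) {C : ℝ} (hC : ∀ k q, |tensorBasis a b c d Bx By k q| ≤ C)
    (hpos : (gram ν (tensorBasis a b c d Bx By)).PosDef) {S : ℝ × ℝ → ℝ} (hS : Integrable S ν)
    (hS2 : Integrable (fun q => S q ^ 2) ν) {Θ : Matrix (Fin R) (Fin L) ℝ}
    (hΘ : Θ ≠ bestCoeff ν a b c d Bx By S) :
    sqDist ν Bx By S (bestCoeff ν a b c d Bx By S) < sqDist ν Bx By S Θ := by
  have hW := fun k => measurable_tensorBasis (a := a) (b := b) (c := c) (d := d) hBx hBy k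
  have hdist : ∀ Θ, sqDist ν Bx By S Θ = ∫ q, S q ^ 2 ∂ν
      + (Θ.vec ⬝ᵥ gram ν (tensorBasis a b c d Bx By) *ᵥ Θ.vec
        - 2 * (momentVector ν (tensorBasis a b c d Bx By) S ⬝ᵥ Θ.vec)) := by
    intro Θ
    rw [← integral_sub_sum_sq hW hC hS hS2, sqDist]
    refine integral_congr_ae ?_
    filter_upwards [hν] with q hq
    rw [tensorSpline_eq_sum hq]
  rw [hdist, hdist, add_lt_add_iff_left]
  have hvec : (bestCoeff ν a b c d Bx By S).vec = (gram ν (tensorBasis a b c d Bx By))⁻¹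
    *ᵥ momentVector ν (tensorBasis a b c d Bx By) S := rfl
  refine quadratic_lt_of_posDef hpos ?_ fun h => hΘ (Matrix.vec_inj.1 h)
  rw [hvec, mulVec_inv_mulVec hpos.det_pos.ne']

lemma tendsto_frobenius_norm_zero {ι : Type*} {F : Filter ι} {A : ι → Matrix (Fin R) (Fin L) ℝ}
    (h : ∀ r l, Tendsto (fun i => A i r l) F (𝓝 0)) : Tendsto (fun i => ‖A i‖) F (𝓝 0) := by
  simp_rw [Matrix.frobenius_norm_def]
  have h1 : Tendsto (fun i => ∑ r, ∑ l, ‖A i r l‖ ^ (2 : ℝ)) F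
      (𝓝 (∑ _r : Fin R, ∑ _l : Fin L, ‖(0 : ℝ)‖ ^ (2 : ℝ))) :=
    tendsto_finsetSum _ fun r _ => tendsto_finsetSum _ fun l _ =>
      (h r l).norm.rpow_const (Or.inr (by norm_num))
  have h2 := h1.rpow_const (p := 1 / 2) (Or.inr (by norm_num))
  simpa using h2

end TensorProduct

/-! ### Independence and laws of the observations -/

section Sampling

variable {Ω : Type*} [MeasurableSpace Ω] {P : Measure Ω} {X Y e : ℕ → Ω → ℝ}

lemma measurable_vecCons_three (hX : ∀ j, Measurable (X j)) (hY : ∀ j, Measurable (Y j))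
    (he : ∀ j, Measurable (e j)) (k : Fin 3 × ℕ) : Measurable (![X, Y, e] k.1 k.2) := by
  obtain ⟨i, j⟩ := k
  fin_cases i
  exacts [hX j, hY j, he j]

/-- The observations `((X j, Y j), e j)` are pairwise independent. -/
lemma pairwise_indepFun_sample (hX : ∀ j, Measurable (X j)) (hY : ∀ j, Measurable (Y j))
    (he : ∀ j, Measurable (e j))
    (hindep : iIndepFun (fun k : Fin 3 × ℕ => ![X, Y, e] k.1 k.2) P) :
    Pairwise fun i j => IndepFun (fun ω => ((X i ω, Y i ω), e i ω))
      (fun ω => ((X j ω, Y j ω), e j ω)) P := by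
  intro i j hij
  have hdisj : Disjoint ((Finset.univ : Finset (Fin 3)) ×ˢ {i}) (Finset.univ ×ˢ {j}) := by
    rw [Finset.disjoint_left]
    rintro ⟨k, n⟩ h1 h2
    simp only [Finset.mem_product, Finset.mem_singleton] at h1 h2
    exact hij (h1.2.symm.trans h2.2)
  have hmem : ∀ (k : Fin 3) (n : ℕ), (k, n) ∈ (Finset.univ : Finset (Fin 3)) ×ˢ ({n} : Finset ℕ) :=
    fun k n => by simp
  have h := hindep.indepFun_finset _ _ hdisj (measurable_vecCons_three hX hY he)
  have hφ : ∀ n : ℕ, Measurable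
      fun v : ((Finset.univ : Finset (Fin 3)) ×ˢ ({n} : Finset ℕ) : Finset (Fin 3 × ℕ)) → ℝ =>
        ((v ⟨(0, n), hmem 0 n⟩, v ⟨(1, n), hmem 1 n⟩), v ⟨(2, n), hmem 2 n⟩) := fun n => by
    fun_prop
  exact h.comp (hφ i) (hφ j)

lemma map_sample [IsProbabilityMeasure P] {h g : Measure ℝ} (hX : ∀ j, Measurable (X j))
    (hY : ∀ j, Measurable (Y j)) (he : ∀ j, Measurable (e j)) (hXlaw : ∀ j, P.map (X j) = h)
    (hYlaw : ∀ j, P.map (Y j) = g) (heident : ∀ j, IdentDistrib (e j) (e 0) P P)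
    (hindep : iIndepFun (fun k : Fin 3 × ℕ => ![X, Y, e] k.1 k.2) P) (j : ℕ) :
    P.map (fun ω => (X j ω, Y j ω)) = h.prod g ∧
      P.map (fun ω => ((X j ω, Y j ω), e j ω)) = (h.prod g).prod (P.map (e 0)) := by
  have hm := measurable_vecCons_three hX hY he
  have h1 : IndepFun (X j) (Y j) P :=
    hindep.indepFun (i := ((0 : Fin 3), j)) (j := ((1 : Fin 3), j)) (by simp)
  have h2 : IndepFun (fun ω => (X j ω, Y j ω)) (e j) P :=
    hindep.indepFun_prodMk hm ((0 : Fin 3), j) ((1 : Fin 3), j) ((2 : Fin 3), j) (by simp)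
      (by simp)
  have e1 := (indepFun_iff_map_prod_eq_prod_map_map (hX j).aemeasurable (hY j).aemeasurable).1 h1
  rw [hXlaw, hYlaw] at e1
  refine ⟨e1, ?_⟩
  have e2 := (indepFun_iff_map_prod_eq_prod_map_map ((hX j).prodMk (hY j)).aemeasurable
    (he j).aemeasurable).1 h2
  rw [e2, e1, (heident j).map_eq]

lemma ae_forall_mem_of_map {h : Measure ℝ} (hX : ∀ j, Measurable (X j))
    (hXlaw : ∀ j, P.map (X j) = h) {s : Set ℝ} (hs : MeasurableSet s) (hh : h sᶜ = 0) :
    ∀ᵐ ω ∂P, ∀ j, X j ω ∈ s := by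
  rw [ae_all_iff]
  intro j
  rw [← hXlaw j, Measure.map_apply (hX j) hs.compl] at hh
  exact hh

end Sampling

/-! ### Consistency of the least-squares coefficients -/

theorem lemma2
    {Ω : Type*} [MeasurableSpace Ω] (P : Measure Ω) [IsProbabilityMeasure P]
    (a b c d : ℝ) (hab : a < b) (hcd : c < d)
    -- design distributions on `[a, b]` and `[c, d]`
    (h g : Measure ℝ) [IsProbabilityMeasure h] [IsProbabilityMeasure g]
    (hh : h (Icc a b)ᶜ = 0) (hg : g (Icc c d)ᶜ = 0)
    -- the two B-spline bases, linearly independent on the supports of `h` and `g`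
    (p q R L : ℕ) (t τ : ℕ → ℝ)
    (ht : IsKnotVector t p R a b) (hτ : IsKnotVector τ q L c d)
    (hBx : LinearIndependent ℝ (fun r : Fin R => h.support.domRestrict (bsplineBasis t p R r)))
    (hBy : LinearIndependent ℝ (fun l : Fin L => g.support.domRestrict (bsplineBasis τ q L l)))
    -- design points and measurement errors
    (X Y e : ℕ → Ω → ℝ)
    (hX : ∀ j, Measurable (X j)) (hY : ∀ j, Measurable (Y j)) (he : ∀ j, Measurable (e j))
    (hXlaw : ∀ j, P.map (X j) = h) (hYlaw : ∀ j, P.map (Y j) = g)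
    (heident : ∀ j, IdentDistrib (e j) (e 0) P P)
    (hemem : MemLp (e 0) 2 P) (hemean : ∫ ω, e 0 ω ∂P = 0)
    (hindep : iIndepFun (fun k : Fin 3 × ℕ => ![X, Y, e] k.1 k.2) P) :
    -- almost surely, the least-squares problem is eventually uniquely solved by `lsCoeff`
    (∀ᵐ ω ∂P, ∀ᶠ m : ℕ in atTop, ∀ z : Fin m → ℝ, ∀ Θ : Matrix (Fin R) (Fin L) ℝ,
      Θ ≠ lsCoeff (bsplineBasis t p R) (bsplineBasis τ q L)
            (fun j : Fin m => X j ω) (fun j : Fin m => Y j ω) z →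
        residualSS (bsplineBasis t p R) (bsplineBasis τ q L)
            (fun j : Fin m => X j ω) (fun j : Fin m => Y j ω) z
            (lsCoeff (bsplineBasis t p R) (bsplineBasis τ q L)
              (fun j : Fin m => X j ω) (fun j : Fin m => Y j ω) z)
          < residualSS (bsplineBasis t p R) (bsplineBasis τ q L)
              (fun j : Fin m => X j ω) (fun j : Fin m => Y j ω) z Θ) ∧
    ∃ proj : (ℝ × ℝ → ℝ) → Matrix (Fin R) (Fin L) ℝ,
      -- `proj S` is the unique coefficient matrix of the best approximation of `S` in `L²(h ⊗ g)`
      (∀ S ∈ surfaceSpace a b c d,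
        Integrable (fun v => S v ^ 2) (h.prod g) ∧
        ∀ Θ : Matrix (Fin R) (Fin L) ℝ, Θ ≠ proj S →
          sqDist (h.prod g) (bsplineBasis t p R) (bsplineBasis τ q L) S (proj S)
            < sqDist (h.prod g) (bsplineBasis t p R) (bsplineBasis τ q L) S Θ) ∧
      -- almost surely, uniform convergence over every class of uniformly bounded variation
      (∀ᵐ ω ∂P, ∀ V : ℝ≥0, ∀ δ > 0, ∀ᶠ m : ℕ in atTop, ∀ S ∈ surfaceClass a b c d V,
        ‖lsCoeff (bsplineBasis t p R) (bsplineBasis τ q L)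
            (fun j : Fin m => X j ω) (fun j : Fin m => Y j ω)
            (fun j : Fin m => S (X j ω, Y j ω) + e j ω) - proj S‖ < δ) ∧
      -- almost surely, convergence for all surfaces of the space
      (∀ᵐ ω ∂P, ∀ S ∈ surfaceSpace a b c d,
        Tendsto (fun m : ℕ =>
          ‖lsCoeff (bsplineBasis t p R) (bsplineBasis τ q L)
            (fun j : Fin m => X j ω) (fun j : Fin m => Y j ω)
            (fun j : Fin m => S (X j ω, Y j ω) + e j ω) - proj S‖) atTop (𝓝 0)) := by
  set Bx := bsplineBasis t p R
  set By := bsplineBasis τ q L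
  set W := tensorBasis a b c d Bx By
  have hQ : IsCompact (Icc a b ×ˢ Icc c d) := isCompact_Icc.prod isCompact_Icc
  have hν := ae_mem_rect hh hg
  have mBx : ∀ r, Measurable (Bx r) := fun r => measurable_bspline t (t R) p r
  have mBy : ∀ l, Measurable (By l) := fun l => measurable_bspline τ (τ L) q l
  have hW : ∀ k, Measurable (W k) := measurable_tensorBasis mBx mBy
  obtain ⟨C, hC⟩ : ∃ C, ∀ k q, |W k q| ≤ C :=
    exists_abs_tensorBasis_le (fun r => exists_abs_bspline_le t (t R) p r a b)
      (fun l => exists_abs_bspline_le τ (τ L) q l c d)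
  have hone : ∀ z ∈ Icc a b ×ˢ Icc c d, ∑ k, W k z = 1 := fun z hz =>
    sum_tensorBasis (fun x hx => ht.sum_bsplineBasis hab hx)
      (fun y hy => hτ.sum_bsplineBasis hcd hy) hz
  have hpos : (gram (h.prod g) W).PosDef := posDef_gram hW hC
    (tensorBasis_linearIndependent hh hg (fun v hv => ht.eq_zero_of_ae_eq_zero hab hh hBx hv)
      (fun v hv => hτ.eq_zero_of_ae_eq_zero hcd hg hBy hv))
  have hdet := hpos.det_pos.ne'
  -- the laws of large numbers
  have hsample := map_sample hX hY he hXlaw hYlaw heident hindep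
  have hpair := pairwise_indepFun_sample hX hY he hindep
  have hpairZ : Pairwise fun i j =>
      IndepFun (fun ω => (X i ω, Y i ω)) (fun ω => (X j ω, Y j ω)) P :=
    fun i j hij => (hpair hij).comp measurable_fst measurable_fst
  have hZ : ∀ j, Measurable fun ω => (X j ω, Y j ω) := fun j => (hX j).prodMk (hY j)
  have aeG : ∀ᵐ ω ∂P, ∀ k l, Tendsto
      (fun m => empiricalGram W (fun j => (X j ω, Y j ω)) m k l) atTop (𝓝 (gram (h.prod g) W k l)) := by
    rw [ae_all_iff]
    intro k
    rw [ae_all_iff]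
    intro l
    filter_upwards [ae_tendsto_empiricalError hZ (fun j => (hsample j).1) hpairZ
      ((hW k).mul (hW l)) (integrable_mul_of_bound hW hC (integrable_of_bound hW hC k) l)] with ω hω
    simpa [empiricalError, empiricalGram, gram] using hω.add_const (gram (h.prod g) W k l)
  have aeE : ∀ᵐ ω ∂P, ∀ k, Tendsto
      (fun m => empiricalMoment W (fun j => (X j ω, Y j ω)) m (fun j => e j ω) k) atTop (𝓝 0) := by
    rw [ae_all_iff]
    intro k
    have he0 : Integrable (fun s : ℝ => s) (P.map (e 0)) :=
      (integrable_map_measure measurable_id.aestronglyMeasurable (he 0).aemeasurable).2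
        (hemem.integrable (by norm_num))
    have : IsProbabilityMeasure (P.map (e 0)) :=
      Measure.isProbabilityMeasure_map (he 0).aemeasurable
    have hzero : ∫ v, W k v.1 * v.2 ∂((h.prod g).prod (P.map (e 0))) = 0 := by
      rw [integral_prod_mul (W k) fun s : ℝ => s,
        integral_map (he 0).aemeasurable measurable_id'.aestronglyMeasurable, hemean, mul_zero]
    filter_upwards [ae_tendsto_empiricalError (fun j => (hZ j).prodMk (he j))
      (fun j => (hsample j).2) hpair (f := fun v => W k v.1 * v.2)
      (((hW k).comp measurable_fst).mul measurable_snd)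
      ((integrable_of_bound hW hC k).mul_prod he0)] with ω hω
    simp only [empiricalError, hzero, sub_zero] at hω
    simpa [empiricalMoment, mul_comm] using hω
  have aeD : ∀ᵐ ω ∂P, ∀ k, ∀ ε > 0, ∀ᶠ m in atTop, ∀ u ∈ Icc a b, ∀ v ∈ Icc c d,
      |empiricalError (h.prod g) (fun j => (X j ω, Y j ω)) m ((Ici u ×ˢ Ici v).indicator (W k))|
        ≤ ε := by
    rw [ae_all_iff]
    exact fun k => ae_eventually_abs_empiricalError_quadrant_le hZ (fun j => (hsample j).1) hpairZ
      (hW k) (hC k) a b c d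
  have aeQ : ∀ᵐ ω ∂P, ∀ j, (X j ω, Y j ω) ∈ Icc a b ×ˢ Icc c d := by
    filter_upwards [ae_forall_mem_of_map hX hXlaw measurableSet_Icc hh,
      ae_forall_mem_of_map hY hYlaw measurableSet_Icc hg] with ω h1 h2 j
    exact ⟨h1 j, h2 j⟩
  have uniform : ∀ᵐ ω ∂P, ∀ V : ℝ≥0, ∀ δ > 0, ∀ᶠ m : ℕ in atTop, ∀ S ∈ surfaceClass a b c d V,
      ‖lsCoeff Bx By (fun j : Fin m => X j ω) (fun j : Fin m => Y j ω)
        (fun j : Fin m => S (X j ω, Y j ω) + e j ω) - bestCoeff (h.prod g) a b c d Bx By S‖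
          < δ := by
    filter_upwards [aeG, aeE, aeD, aeQ] with ω hG hE hD hz V δ hδ
    have hlim := tendsto_frobenius_norm_zero (A := fun x : ℕ × (ℝ × ℝ → ℝ) =>
        (Matrix.of fun r l => ((empiricalGram W (fun j => (X j ω, Y j ω)) x.1)⁻¹
          *ᵥ empiricalMoment W (fun j => (X j ω, Y j ω)) x.1
            (fun j => x.2 (X j ω, Y j ω) + e j ω)) (l, r)
          - ((gram (h.prod g) W)⁻¹ *ᵥ momentVector (h.prod g) W x.2) (l, r)))
      fun r l => tendsto_leastSquares_sub hab hcd hν hz hW hC hone hdet hG hE hD V (l, r)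
    have hlt := hlim.eventually_lt_const hδ
    rw [eventually_prod_principal_iff] at hlt
    filter_upwards [hlt, (tendsto_inv_empiricalGram hG hdet).1, eventually_gt_atTop 0]
      with m hm hdm hm0 S hS
    refine lt_of_eq_of_lt (congrArg _ ?_) (hm S ⟨hS.1.1, hS.2⟩)
    ext r l
    rw [Matrix.sub_apply, lsCoeff_apply hz hm0 hdm (fun j => S (X j ω, Y j ω) + e j ω)]
    rfl
  refine ⟨?_, bestCoeff (h.prod g) a b c d Bx By, ?_, uniform, ?_⟩
  · filter_upwards [aeG, aeQ] with ω hG hz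
    -- `m = 0` is left out: the means over no points are junk
    filter_upwards [(tendsto_inv_empiricalGram hG hdet).1, eventually_gt_atTop 0]
      with m hdm hm0 z Θ hΘ
    exact residualSS_lsCoeff_lt (det_transpose_mul_designMatrix_ne_zero hz hm0 hdm) z hΘ
  · intro S hS
    have hS2 := integrable_of_continuousOn hQ hν (hS.1.1.pow 2)
    exact ⟨hS2, fun Θ hΘ => sqDist_bestCoeff_lt hν mBx mBy hC hpos
      (integrable_of_continuousOn hQ hν hS.1.1) hS2 hΘ⟩
  · filter_upwards [uniform] with ω hω S hS
    rw [Metric.tendsto_nhds]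
    intro δ hδ
    have hV : S ∈ surfaceClass a b c d (hkVariation a b c d S).toNNReal :=
      ⟨hS.1, (ENNReal.coe_toNNReal hS.2.ne).ge⟩
    filter_upwards [hω _ δ hδ] with m hm
    rw [Real.dist_eq, sub_zero, abs_of_nonneg (norm_nonneg _)]
    exact hm S hV
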